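/- **Model.** Let $d\ge 1$ modes $\Xi=\{1,\dots,d\}$, a horizon $T\ge 0$, a finite-dimensional Euclidean space $\mathcal B$, observations $y_t\in\mathbb R^{n_y}$ ($t\le T$, including the finitely many past observations that are used), and $z_t=\Upsilon(y_t,\dots,y_{t-t_y+1})\in\mathbb R^{n_z}$ with a known map $\Upsilon$ be given. The parameter is $\theta=(\Theta,\beta)$, $\Theta=(\Theta_i)_{i=1}^d$, $\Theta_i\in\mathbb R^{n_z\times d}$ with $j$th column $\Theta_{i,j}$, $\beta=(\beta_1,\dots,\beta_d)\in\mathcal B^d$, with the Euclidean norm. The model is $$p(\xi_{t+1}=j\mid z_t,\xi_t=i;\Theta)=\frac{\exp(\Theta_{i,j}^\top z_t)}{\sum_{l=1}^d\exp(\Theta_{i,l}^\top z_t)},$$ $$p(y_{t+1}\mid z_t,\xi_{t+1}=j;\beta)=C\exp\big(-f(\ell(y_{t+1},z_t,\beta_j))-g(y_{t+1},z_t,\beta_j)\big),$$ where $C=C(y_{t+1},z_t)>0$ does not depend on the parameter, $f:\mathcal X_f\to\mathbb R$, $\ell:\mathbb R^{n_y}\times\mathbb R^{n_z}\times\mathcal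 X_\beta\to\mathcal X_f$, $g:\mathbb R^{n_y}\times\mathbb R^{n_z}\times\mathcal X_\beta\to\mathbb R$. Write $\ell_t=\ell(y_{t+1},z_t,\cdot)$, $g_t=g(y_{t+1},z_t,\cdot)$, and let $p(\xi_0,z_0)\ge 0$, not identically zero in $\xi_0$, be independent of $\theta$. For $\xi=(\xi_0,\dots,\xi_T)\in\Xi^{T+1}$ put $$p(y,\xi,z_0;\theta)=p(\xi_0,z_0)\prod_{t=0}^{T-1}p(y_{t+1}\mid z_t,\xi_{t+1};\beta)\,p(\xi_{t+1}\mid z_t,\xi_t;\Theta),$$ $$\Psi_\xi(\Theta)=\sum_{t=0}^{T-1}\Big(\ln\sum_{l=1}^d e^{\Theta_{\xi_t,l}^\top z_t}-\Theta_{\xi_t,\xi_{t+1}}^\top z_t\Big),\qquad \Phi_\xi(\beta)=\sum_{t=0}^{T-1}\big(f(\ell_t(\beta_{\xi_{t+1}}))+g_t(\beta_{\xi_{t+1}})\big).$$ On $\mathcal X_\theta=\mathbb R^{d\times n_z\times d}\times\mathcal X_\beta^d$ let $\mathcal L(\theta)=-\ln\sum_{\xi}p(y,\xi,z_0;\theta)$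 and $\bar{\mathcal L}=\mathcal L+\mathcal R$ with a regularizer $\mathcal R(\theta)=\mathcal R_1(\Theta)+\mathcal R_2(\beta)$; put $\bar{\mathcal L}=+\infty$ outside $\mathcal X_\theta$. **Assumption 1.** $\mathcal X_\beta\subseteq\mathcal B$ and $\mathcal X_f\subseteq\mathbb R$ are open and convex; for all $y,z$, the functions $\ell(y,z,\cdot)$ and $g(y,z,\cdot)$ are convex and locally Lipschitz on $\mathcal X_\beta$; $f$ is $C^1$, concave and strictly increasing on $\mathcal X_f$, with $f'\le\bar u$ for some $\bar u\in(0,\infty)$. **Assumption 2.** $\mathcal R_1$ (on $\mathbb R^{d\times n_z\times d}$) and $\mathcal R_2$ (on $\mathcal X_\beta^d$) are convex, and there are $\kappa_1,\kappa_2>0$, $c_1,c_2\in\mathbb R$ such that, for every $\xi\in\Xi^{T+1}$, $\Psi_\xi(\Theta)+\mathcal R_1(\Theta)\ge\kappa_1\|\Theta\|+c_1$ for all $\Theta$ and $\Phi_\xi(\beta)+\mathcal R_2(\beta)\ge\kappa_2\|\beta\|+c_2$ for all $\beta\in\mathcal X_\beta^d$. **Assumption 3.** For $t=0,\dots,T-1$,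 $\ell_t$ and $g_t$ are $C^1$ on $\mathcal X_\beta$ with gradients Lipschitz continuous on every compact subset of $\mathcal X_\beta$; $f'$ is Lipschitz continuous on every compact subset of $\mathcal X_f$; $\mathcal R$ is $C^2$ with $\nabla^2\mathcal R(\theta)\succ0$ on $\mathcal X_\theta$. **EM++.** With $\Pi_\xi(\theta)=p(y,\xi,z_0;\theta)/\sum_{\xi'}p(y,\xi',z_0;\theta)$, EM++ iterates are a sequence $\theta^k=(\Theta^k,\beta^k)$ with $\theta^0\in\mathcal X_\theta$ and, for all $k\ge0$, $$\Theta^{k+1}\in\operatorname*{argmin}_{\Theta}\ \sum_\xi\Pi_\xi(\theta^k)\Psi_\xi(\Theta)+\mathcal R_1(\Theta),\qquad \beta^{k+1}\in\operatorname*{argmin}_{\beta\in\mathcal X_\beta^d}\ \sum_\xi\Pi_\xi(\theta^k)\hat\Phi^k_\xi(\beta)+\mathcal R_2(\beta),$$ where $\hat\Phi^k_\xi$ is $\Phi_\xi$ with each $f(\ell_t(\beta_{\xi_{t+1}}))$ replaced by $f(x)+f'(x)\,(\ell_t(\beta_{\xi_{t+1}})-x)$, $x=\ell_t(\beta^k_{\xi_{t+1}})$.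 **KL property.** A *KL function* of $\eta:\mathbb R^n\to\mathbb R\cup\{\infty\}$ at a point $\bar\theta$ with $\eta(\bar\theta)<\infty$ is a concave $\psi:[0,b]\to[0,\infty)$, $b>0$, with $\psi(0)=0$, $\psi\in C^1(0,b)$, $\psi'>0$ on $(0,b)$, such that for all $\theta$ in a neighbourhood of $\bar\theta$ with $\eta(\bar\theta)<\eta(\theta)<\eta(\bar\theta)+b$ one has $\psi'(\eta(\theta)-\eta(\bar\theta))\,\mathrm{dist}(0,\partial\eta(\theta))\ge1$, $\partial$ being the limiting subdifferential. The function $\eta$ *satisfies the KL property* if it is proper, lower semicontinuous, and has a KL function at every point where it is finite. **Theorem (Global convergence).** Let Assumptions 1–3 hold and let $\bar{\mathcal L}$ (extended by $+\infty$ outside $\mathcal X_\theta$) satisfy the KL property. Let $\{\theta^k\}_{k\in\mathbb N}$ be EM++ iterates. Then the whole sequence converges to some $\theta^\star\in\mathcal X_\theta$ with $\nabla\bar{\mathcal L}(\theta^\star)=0$. If, in addition, $\bar{\mathcal L}$ has at $\theta^\star$ a KL function of the form $\psi(s)=c\,s^{1-\alpha}$ with $c>0$, $\alpha\in[0,1)$,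 then: 1. if $\alpha=0$, then $\theta^k=\theta^\star$ for all sufficiently large $k$; 2. if $\alpha\in(0,1/2]$, there are $\omega>0$ and $\tau\in[0,1)$ with $\|\theta^k-\theta^\star\|\le\omega\tau^k$ for all $k\ge 0$; 3. if $\alpha\in(1/2,1)$, there is $\omega>0$ with $\|\theta^k-\theta^\star\|\le\omega\,k^{-\frac{1-\alpha}{2\alpha-1}}$ for all $k\ge1$. -/

import Mathlib

open Filter Topology

noncomputable section

namespace EMpp

/-! ### Parameter spaces and elementary functions -/

/-- Switching parameters `Θ = (Θ_1, …, Θ_d)`, `Θ_i ∈ ℝ^{n_z × d}`: the entry of `Θ_i` in row `a`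
and column `j` is `Θ (i, a, j)`. The norm is the Euclidean one. -/
abbrev SwitchParam (d nz : ℕ) : Type := EuclideanSpace ℝ (Fin d × Fin nz × Fin d)

/-- Subsystem parameters `β = (β_1, …, β_d) ∈ 𝓑^d`, with the Euclidean product norm. -/
abbrev SubsysParam (d : ℕ) (B : Type*) : Type _ := PiLp 2 (fun _ : Fin d => B)

/-- The full parameter `θ = (Θ, β)`, with the Euclidean product norm. -/
abbrev Param (d nz : ℕ) (B : Type*) : Type _ := WithLp 2 (SwitchParam d nz × SubsysParam d B)

/-- Log-sum-exp. -/
def lse {ι : Type*} [Fintype ι] (x : ι → ℝ) : ℝ := Real.log (∑ j, Real.exp (x j))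

/-- Entry `i` of the softmax function. -/
def softmax {ι : Type*} [Fintype ι] (x : ι → ℝ) (i : ι) : ℝ :=
  Real.exp (x i) / ∑ j, Real.exp (x j)

/-- The vector `Θ_iᵀ z ∈ ℝ^d`; its entry `j` is `Θ_{i,j}ᵀ z`, with `Θ_{i,j}` column `j` of `Θ_i`. -/
def switchScore {d nz : ℕ} (Θ : SwitchParam d nz) (i : Fin d) (z : EuclideanSpace ℝ (Fin nz)) :
    Fin d → ℝ :=
  fun j => ∑ a, Θ (i, a, j) * z a

/-! ### The switching system and the regularized negative log-likelihood -/

/-- The data of the identification problem: the functions defining the switching system with `d`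
modes, and an observed trajectory of length `T`. Functions on `Xf` and `Xβ` are represented by total
functions whose values outside these sets play no role. -/
structure SwitchingModel (d ny nz ty T : ℕ) (B : Type*) where
  /-- domain of `f` -/
  Xf : Set ℝ
  /-- domain of the subsystem parameter -/
  Xβ : Set B
  f : ℝ → ℝ
  ell : EuclideanSpace ℝ (Fin ny) → EuclideanSpace ℝ (Fin nz) → B → ℝ
  g : EuclideanSpace ℝ (Fin ny) → EuclideanSpace ℝ (Fin nz) → B → ℝ
  /-- the factor of the subsystem density that does not depend on the parameter -/
  C : EuclideanSpace ℝ (Fin ny) → EuclideanSpace ℝ (Fin nz) → ℝ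
  /-- the map producing `z_t` from the window `(y_t, …, y_{t - ty + 1})` -/
  history : (Fin ty → EuclideanSpace ℝ (Fin ny)) → EuclideanSpace ℝ (Fin nz)
  /-- the observations; only `y_t` with `-ty < t ≤ T` is ever used -/
  y : ℤ → EuclideanSpace ℝ (Fin ny)
  /-- `p0 i = p(ξ_0 = i, z_0)`, which does not depend on the parameter -/
  p0 : Fin d → ℝ

namespace SwitchingModel

variable {d ny nz ty T : ℕ} {B : Type*}

/-- `z_t = Υ(y_t, …, y_{t - ty + 1})`. -/
def z (m : SwitchingModel d ny nz ty T B) (t : ℕ) : EuclideanSpace ℝ (Fin nz) :=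
  m.history (fun s => m.y ((t : ℤ) - (s : ℤ)))

/-- `ℓ_t(β) = ℓ(y_{t+1}, z_t, β)`. -/
def ellAt (m : SwitchingModel d ny nz ty T B) (t : ℕ) (b : B) : ℝ :=
  m.ell (m.y ((t : ℤ) + 1)) (m.z t) b

/-- `g_t(β) = g(y_{t+1}, z_t, β)`. -/
def gAt (m : SwitchingModel d ny nz ty T B) (t : ℕ) (b : B) : ℝ :=
  m.g (m.y ((t : ℤ) + 1)) (m.z t) b

/-- `p(y_{t+1} ∣ z_t, ξ_{t+1} = j; β)`, where `b = β_j`. -/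
def subsysDensity (m : SwitchingModel d ny nz ty T B) (t : ℕ) (b : B) : ℝ :=
  m.C (m.y ((t : ℤ) + 1)) (m.z t) * Real.exp (-m.f (m.ellAt t b) - m.gAt t b)

/-- `p(ξ_{t+1} = j ∣ z_t, ξ_t = i; Θ)`. -/
def switchProb (m : SwitchingModel d ny nz ty T B) (t : ℕ) (Θ : SwitchParam d nz)
    (i j : Fin d) : ℝ :=
  softmax (switchScore Θ i (m.z t)) j

/-- The joint density `p(y, ξ, z_0; θ)` for a mode sequence `ξ = (ξ_0, …, ξ_T)`. -/
def joint (m : SwitchingModel d ny nz ty T B) (θ : Param d nz B) (ξ : Fin (T + 1) → Fin d) : ℝ :=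
  m.p0 (ξ 0) * ∏ t : Fin T,
    (m.subsysDensity t (θ.snd (ξ t.succ)) * m.switchProb t θ.fst (ξ t.castSucc) (ξ t.succ))

/-- The negative log-likelihood `-ln p(y, z_0; θ)`. -/
def nll (m : SwitchingModel d ny nz ty T B) (θ : Param d nz B) : ℝ :=
  -Real.log (∑ ξ, m.joint θ ξ)

/-- The domain `𝒳_β^d` of the subsystem parameters. -/
def domβ (m : SwitchingModel d ny nz ty T B) : Set (SubsysParam d B) := {β | ∀ j, β j ∈ m.Xβ}

/-- The domain `𝒳_θ = ℝ^{d × n_z × d} × 𝒳_β^d`. -/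
def domθ (m : SwitchingModel d ny nz ty T B) : Set (Param d nz B) := {θ | θ.snd ∈ m.domβ}

/-- The regularizer `ℛ(θ) = ℛ₁(Θ) + ℛ₂(β)`. -/
def reg (R₁ : SwitchParam d nz → ℝ) (R₂ : SubsysParam d B → ℝ) (θ : Param d nz B) : ℝ :=
  R₁ θ.fst + R₂ θ.snd

/-- The regularized negative log-likelihood (meaningful on `domθ`). -/
def regLoss (m : SwitchingModel d ny nz ty T B) (R₁ : SwitchParam d nz → ℝ)
    (R₂ : SubsysParam d B → ℝ) (θ : Param d nz B) : ℝ :=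
  m.nll θ + reg R₁ R₂ θ

open Classical in
/-- The regularized negative log-likelihood as an extended-real function on the whole parameter
space, equal to `+∞` outside its domain. -/
def extRegLoss (m : SwitchingModel d ny nz ty T B) (R₁ : SwitchParam d nz → ℝ)
    (R₂ : SubsysParam d B → ℝ) (θ : Param d nz B) : EReal :=
  if θ ∈ m.domθ then (m.regLoss R₁ R₂ θ : EReal) else ⊤

/-- `Ψ_ξ(Θ)`. -/
def Psi (m : SwitchingModel d ny nz ty T B) (ξ : Fin (T + 1) → Fin d) (Θ : SwitchParam d nz) : ℝ :=
  ∑ t : Fin T, (lse (switchScore Θ (ξ t.castSucc) (m.z t))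
    - switchScore Θ (ξ t.castSucc) (m.z t) (ξ t.succ))

/-- `Φ_ξ(β)`. -/
def Phi (m : SwitchingModel d ny nz ty T B) (ξ : Fin (T + 1) → Fin d) (β : SubsysParam d B) : ℝ :=
  ∑ t : Fin T, (m.f (m.ellAt t (β (ξ t.succ))) + m.gAt t (β (ξ t.succ)))

/-! ### The EM++ iteration -/

/-- The posterior `Π_ξ(θ) = p(ξ ∣ y, z_0; θ)`. -/
def posterior (m : SwitchingModel d ny nz ty T B) (θ : Param d nz B)
    (ξ : Fin (T + 1) → Fin d) : ℝ :=
  m.joint θ ξ / ∑ ξ', m.joint θ ξ'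

/-- The linearization `f[x₀](x) = f(x₀) + f'(x₀) (x - x₀)`. -/
def linf (m : SwitchingModel d ny nz ty T B) (x₀ x : ℝ) : ℝ :=
  m.f x₀ + deriv m.f x₀ * (x - x₀)

/-- The majorizer of `Φ_ξ` at `β₀`, obtained by linearizing `f`. -/
def PhiHat (m : SwitchingModel d ny nz ty T B) (β₀ : SubsysParam d B)
    (ξ : Fin (T + 1) → Fin d) (β : SubsysParam d B) : ℝ :=
  ∑ t : Fin T, (m.linf (m.ellAt t (β₀ (ξ t.succ))) (m.ellAt t (β (ξ t.succ)))
    + m.gAt t (β (ξ t.succ)))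

/-- The part of the surrogate at `θ₀` that depends on `Θ`. -/
def Q₁ (m : SwitchingModel d ny nz ty T B) (θ₀ : Param d nz B) (Θ : SwitchParam d nz) : ℝ :=
  ∑ ξ, m.posterior θ₀ ξ * m.Psi ξ Θ

/-- The part of the surrogate at `θ₀` that depends on `β`. -/
def Q₂ (m : SwitchingModel d ny nz ty T B) (θ₀ : Param d nz B) (β : SubsysParam d B) : ℝ :=
  ∑ ξ, m.posterior θ₀ ξ * m.PhiHat θ₀.snd ξ β

/-- `θ` is a sequence of EM++ iterates: it starts in the domain, and each iterate consists of
minimizers, over the respective domains, of the two parts of the regularized surrogate constructed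
at the previous iterate. -/
structure IsEMSequence (m : SwitchingModel d ny nz ty T B) (R₁ : SwitchParam d nz → ℝ)
    (R₂ : SubsysParam d B → ℝ) (θ : ℕ → Param d nz B) : Prop where
  init_mem : θ 0 ∈ m.domθ
  switch_min : ∀ k, IsMinOn (fun Θ => m.Q₁ (θ k) Θ + R₁ Θ) Set.univ (θ (k + 1)).fst
  subsys_mem : ∀ k, (θ (k + 1)).snd ∈ m.domβ
  subsys_min : ∀ k, IsMinOn (fun β => m.Q₂ (θ k) β + R₂ β) m.domβ (θ (k + 1)).snd

end SwitchingModel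

/-! ### Assumptions -/

/-- `h` is Lipschitz smooth on every compact subset of the open set `S`: it is continuously
differentiable on `S` and its derivative (equivalently its gradient) is Lipschitz continuous on
every compact subset of `S`. -/
def LipschitzSmoothOnCompacts {E : Type*} [NormedAddCommGroup E] [NormedSpace ℝ E]
    (h : E → ℝ) (S : Set E) : Prop :=
  ContDiffOn ℝ 1 h S ∧ ∀ K ⊆ S, IsCompact K → ∃ L : NNReal, LipschitzOnWith L (fderiv ℝ h) K

namespace SwitchingModel

variable {d ny nz ty T : ℕ} {B : Type*} [NormedAddCommGroup B] [InnerProductSpace ℝ B]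

/-- Basic requirements: the parameter-invariant factor of the subsystem density is positive, and the
initial weights `p(ξ_0, z_0)` are nonnegative and not all zero. -/
structure WellPosed (m : SwitchingModel d ny nz ty T B) : Prop where
  C_pos : ∀ y z, 0 < m.C y z
  p0_nonneg : ∀ i, 0 ≤ m.p0 i
  p0_pos : ∃ i, 0 < m.p0 i

/-- The assumption on the subsystem model. -/
structure SubsystemAssumption (m : SwitchingModel d ny nz ty T B) : Prop where
  Xf_open : IsOpen m.Xf
  Xf_convex : Convex ℝ m.Xf
  Xβ_open : IsOpen m.Xβ
  Xβ_convex : Convex ℝ m.Xβ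
  ell_mapsTo : ∀ y z, Set.MapsTo (m.ell y z) m.Xβ m.Xf
  g_locLipschitz : ∀ y z, LocallyLipschitzOn m.Xβ (m.g y z)
  g_convex : ∀ y z, ConvexOn ℝ m.Xβ (m.g y z)
  ell_locLipschitz : ∀ y z, LocallyLipschitzOn m.Xβ (m.ell y z)
  ell_convex : ∀ y z, ConvexOn ℝ m.Xβ (m.ell y z)
  f_contDiff : ContDiffOn ℝ 1 m.f m.Xf
  f_concave : ConcaveOn ℝ m.Xf m.f
  f_strictMono : StrictMonoOn m.f m.Xf
  f_deriv_bdd : ∃ u : ℝ, 0 < u ∧ ∀ x ∈ m.Xf, deriv m.f x ≤ u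

/-- The assumption on the regularizers. -/
structure RegularizerAssumption (m : SwitchingModel d ny nz ty T B)
    (R₁ : SwitchParam d nz → ℝ) (R₂ : SubsysParam d B → ℝ) : Prop where
  R₁_convex : ConvexOn ℝ Set.univ R₁
  R₂_convex : ConvexOn ℝ m.domβ R₂
  growth : ∃ κ₁ κ₂ c₁ c₂ : ℝ, 0 < κ₁ ∧ 0 < κ₂ ∧ ∀ ξ : Fin (T + 1) → Fin d,
    (∀ Θ, κ₁ * ‖Θ‖ + c₁ ≤ m.Psi ξ Θ + R₁ Θ) ∧
    (∀ β ∈ m.domβ, κ₂ * ‖β‖ + c₂ ≤ m.Phi ξ β + R₂ β)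

/-- The smoothness assumption; `fderiv ℝ (fderiv ℝ ℛ) θ v v` is `⟨v, ∇²ℛ(θ) v⟩`. -/
structure SmoothnessAssumption (m : SwitchingModel d ny nz ty T B)
    (R₁ : SwitchParam d nz → ℝ) (R₂ : SubsysParam d B → ℝ) : Prop where
  ell_smooth : ∀ t : Fin T, LipschitzSmoothOnCompacts (m.ellAt t) m.Xβ
  g_smooth : ∀ t : Fin T, LipschitzSmoothOnCompacts (m.gAt t) m.Xβ
  f_smooth : LipschitzSmoothOnCompacts m.f m.Xf
  reg_contDiff : ContDiffOn ℝ 2 (reg (d := d) (nz := nz) R₁ R₂) m.domθ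
  reg_hess_pos : ∀ θ ∈ m.domθ, ∀ v : Param d nz B, v ≠ 0 →
    0 < fderiv ℝ (fderiv ℝ (reg R₁ R₂)) θ v v

end SwitchingModel

/-! ### The Kurdyka–Łojasiewicz property -/

section KL

variable {E : Type*} [NormedAddCommGroup E] [InnerProductSpace ℝ E]

/-- The regular (Fréchet) subdifferential of `η` at `x`:
`η y ≥ η x + ⟨v, y - x⟩ + o(‖y - x‖)` as `y → x`, with `η x` finite. -/
def regularSubdifferential (η : E → EReal) (x : E) : Set E :=
  {v | η x ≠ ⊤ ∧ η x ≠ ⊥ ∧ ∀ ε : ℝ, 0 < ε →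
    ∀ᶠ y in 𝓝 x, η x + ((inner ℝ v (y - x) - ε * ‖y - x‖ : ℝ) : EReal) ≤ η y}

/-- The (limiting) subdifferential `∂η(x)`. -/
def subdifferential (η : E → EReal) (x : E) : Set E :=
  {v | η x ≠ ⊤ ∧ η x ≠ ⊥ ∧ ∃ u w : ℕ → E, Tendsto u atTop (𝓝 x) ∧
    Tendsto (fun n => η (u n)) atTop (𝓝 (η x)) ∧
    (∀ n, w n ∈ regularSubdifferential η (u n)) ∧ Tendsto w atTop (𝓝 v)}

/-- `ψ : [0, b] → [0, ∞)` is a KL function of `η` at the point `x₀` (where `η x₀` is finite). The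
distance of `0` to the empty set is `∞`. -/
structure IsKLFunctionAt (η : E → EReal) (x₀ : E) (b : ℝ) (ψ : ℝ → ℝ) : Prop where
  b_pos : 0 < b
  nonneg : ∀ s ∈ Set.Icc 0 b, 0 ≤ ψ s
  concave : ConcaveOn ℝ (Set.Icc 0 b) ψ
  map_zero : ψ 0 = 0
  contDiff : ContDiffOn ℝ 1 ψ (Set.Ioo 0 b)
  deriv_pos : ∀ s ∈ Set.Ioo 0 b, 0 < deriv ψ s
  ineq : ∀ᶠ x in 𝓝 x₀, η x₀ < η x → η x < η x₀ + (b : EReal) →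
    1 ≤ ENNReal.ofReal (deriv ψ ((η x).toReal - (η x₀).toReal)) *
      Metric.infEDist 0 (subdifferential η x)

/-- `η` satisfies the KL property: it is proper and lower semicontinuous, and it has a KL function
at every point of its domain. -/
structure SatisfiesKL (η : E → EReal) : Prop where
  ne_bot : ∀ x, η x ≠ ⊥
  exists_ne_top : ∃ x, η x ≠ ⊤
  lsc : LowerSemicontinuous η
  kl : ∀ x, η x ≠ ⊤ → ∃ (b : ℝ) (ψ : ℝ → ℝ), IsKLFunctionAt η x b ψ

end KL

end EMpp

end

noncomputable section

namespace EMpp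

/-! ### Descent sequences satisfying a Kurdyka–Łojasiewicz inequality -/

section DescentSequence

variable {E : Type*} [NormedAddCommGroup E]

/-! EM++ is a majorization-minimization scheme. The joint density is a parameter-free weight times
`exp (-(Psi + Phi))`, so Jensen's inequality bounds the negative log-likelihood by a posterior
average of `Psi + Phi`, and the tangents of the concave `f` bound that average, up to a constant, by
a finite sum `∑ j, A j θ₀ * G j θ`: nonnegative coefficients frozen at the current iterate, convex
terms. The bound is tight at `θ₀`. Since it separates in `Θ` and `β`, an EM++ step minimizes this
sum plus the regularizer (`regLoss_le_surrogate`, `IsEMSequence.isMinOn_surrogate`).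

The iterates stay in the sublevel set of the initial loss, which is compact by coercivity and lower
semicontinuity. There the Hessian of the regularizer is uniformly positive, so the surrogate grows
quadratically around its minimizer and each step lowers the loss by at least `a * ‖step‖ ^ 2`
(`majorization_sufficient_decrease`). At the new point the surrogate built at the old one is
stationary, while the one built at the new point is tangent to the loss. Subtracting, the gradient
of the loss is the sum of the coefficient changes times the gradients of `G j`, hence at most `b *
‖step‖` (`majorization_relative_error`).

These two estimates and a KL inequality at a cluster point make the steps summable, so the whole
sequence converges (`descent_kl_tendsto`). For `ψ s = c * s ^ (1 - α)` with `α > 0` they combine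
into `s (k + 1) ^ (2 * α) ≤ C * (s k - s (k + 1))` for the gap `s` to the limiting loss, and the
rates follow from this recursion. For `α = 0` a positive gap would keep the steps away from zero. -/

/-- Once the gap of a descent sequence vanishes, the sequence stays at its cluster point. -/
lemma descent_eq_of_gap_eq_zero {x : ℕ → E} {s : ℕ → ℝ} {a : ℝ} {xs : E} (ha : 0 < a)
    (hs0 : ∀ k, 0 ≤ s k) (hdesc : ∀ k, s (k + 1) + a * ‖x (k + 1) - x k‖ ^ 2 ≤ s k)
    (hcl : MapClusterPt xs atTop x) {N : ℕ} (hN : s N = 0) : ∀ k ≥ N, x k = xs ∧ s k = 0 := by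
  have h1 : ∀ k ≥ N, x k = x N ∧ s k = 0 := by
    intro k hk
    induction k, hk using Nat.le_induction with
    | base => exact ⟨rfl, hN⟩
    | succ k _ ih =>
      have h := hdesc k
      have h0 := hs0 (k + 1)
      have hsq : 0 ≤ a * ‖x (k + 1) - x k‖ ^ 2 := by positivity
      rw [ih.2] at h
      have hz : a * ‖x (k + 1) - x k‖ ^ 2 = 0 := by linarith
      have hn : x (k + 1) - x k = 0 := by
        rcases mul_eq_zero.1 hz with h | h
        · exact absurd h ha.ne'
        · simpa using h
      exact ⟨by rw [sub_eq_zero.1 hn, ih.1], by linarith⟩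
  have hx : x N = xs := by
    by_contra hne
    have hev : ∀ᶠ k in atTop, x k = x N := eventually_atTop.2 ⟨N, fun k hk => (h1 k hk).1⟩
    have hfr := hcl.frequently (isOpen_ne.mem_nhds (Ne.symm hne) : {z | z ≠ x N} ∈ 𝓝 xs)
    obtain ⟨k, hk, hk'⟩ := (hfr.and_eventually hev).exists
    exact hk hk'
  exact fun k hk => ⟨(h1 k hk).1.trans hx, (h1 k hk).2⟩

lemma descent_gap_antitone {x : ℕ → E} {s : ℕ → ℝ} {a : ℝ} (ha : 0 < a)
    (hdesc : ∀ k, s (k + 1) + a * ‖x (k + 1) - x k‖ ^ 2 ≤ s k) : Antitone s :=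
  antitone_nat_of_succ_le fun k => by
    have : 0 ≤ a * ‖x (k + 1) - x k‖ ^ 2 := by positivity
    linarith [hdesc k]

lemma descent_step_tendsto_zero {x : ℕ → E} {s : ℕ → ℝ} {a : ℝ} (ha : 0 < a)
    (hs : Tendsto s atTop (𝓝 0))
    (hdesc : ∀ k, s (k + 1) + a * ‖x (k + 1) - x k‖ ^ 2 ≤ s k) :
    Tendsto (fun k => ‖x (k + 1) - x k‖) atTop (𝓝 0) := by
  have h1 : Tendsto (fun k => (s k - s (k + 1)) / a) atTop (𝓝 0) := by
    simpa using (hs.sub (hs.comp (tendsto_add_atTop_nat 1))).div_const a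
  have h2 : Tendsto (fun k => ‖x (k + 1) - x k‖ ^ 2) atTop (𝓝 0) := by
    refine squeeze_zero (fun k => by positivity) (fun k => ?_) h1
    rw [le_div_iff₀ ha]
    linarith [hdesc k]
  have h3 := h2.sqrt
  simpa [Real.sqrt_sq] using h3

/-- A descent sequence satisfying a Kurdyka–Łojasiewicz inequality near a cluster point converges
to it, and the distance to the limit is controlled by the desingularizing function. -/
lemma descent_kl_tendsto {x : ℕ → E} {s : ℕ → ℝ} {a b β ρ : ℝ} {ψ : ℝ → ℝ} {xs : E}
    (ha : 0 < a) (hb : 0 < b) (hρ : 0 < ρ) (hs0 : ∀ k, 0 ≤ s k) (hs : Tendsto s atTop (𝓝 0))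
    (hdesc : ∀ k, s (k + 1) + a * ‖x (k + 1) - x k‖ ^ 2 ≤ s k)
    (hcl : MapClusterPt xs atTop x) (hβ : 0 < β)
    (hψ0 : ∀ t ∈ Set.Icc 0 β, 0 ≤ ψ t) (hψc : ConcaveOn ℝ (Set.Icc 0 β) ψ)
    (hψd : DifferentiableOn ℝ ψ (Set.Ioo 0 β)) (hψp : ∀ t ∈ Set.Ioo 0 β, 0 < deriv ψ t)
    (hKL : ∀ k, x (k + 1) ∈ Metric.ball xs ρ → 0 < s (k + 1) → s (k + 1) < β →
      1 ≤ deriv ψ (s (k + 1)) * (b * ‖x (k + 1) - x k‖)) :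
    Tendsto x atTop (𝓝 xs) ∧
      ∃ N, ∀ k ≥ N, ‖x (k + 1) - xs‖ ≤ ‖x (k + 1) - x k‖ + b / a * ψ (s (k + 1)) := by
  by_cases hz : ∃ N, s N = 0
  · obtain ⟨N, hN⟩ := hz
    have h := descent_eq_of_gap_eq_zero ha hs0 hdesc hcl hN
    refine ⟨tendsto_const_nhds.congr' (eventually_atTop.2 ⟨N, fun k hk => (h k hk).1.symm⟩),
      N, fun k hk => ?_⟩
    rw [(h (k + 1) (by omega)).1, (h (k + 1) (by omega)).2]
    have := hψ0 0 ⟨le_rfl, hβ.le⟩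
    simp only [sub_self, norm_zero]
    positivity
  push Not at hz
  have hpos : ∀ k, 0 < s k := fun k => lt_of_le_of_ne (hs0 k) (hz k).symm
  have hanti := descent_gap_antitone ha hdesc
  have hstep := descent_step_tendsto_zero ha hs hdesc
  obtain ⟨N₀, hN₀⟩ := eventually_atTop.1 (hs.eventually (gt_mem_nhds hβ))
  have hmem : ∀ k ≥ N₀, s k ∈ Set.Ioo 0 β := fun k hk => ⟨hpos k, hN₀ k hk⟩
  -- supporting line inequality
  have hslope : ∀ u ∈ Set.Ioo 0 β, ∀ v ∈ Set.Ioo 0 β, v ≤ u →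
      deriv ψ u * (u - v) ≤ ψ u - ψ v := by
    intro u hu v hv hvu
    rcases hvu.eq_or_lt with rfl | hlt
    · simp
    have hd : DifferentiableAt ℝ ψ u := hψd.differentiableAt (isOpen_Ioo.mem_nhds hu)
    have h := hψc.deriv_le_slope (Set.Ioo_subset_Icc_self hv)
      (Set.Ioo_subset_Icc_self hu) hlt hd
    rw [slope_def_field, le_div_iff₀ (sub_pos.2 hlt)] at h
    exact h
  have hψanti : ∀ k ≥ N₀, ψ (s (k + 1)) ≤ ψ (s k) := by
    intro k hk
    have h := hslope _ (hmem k hk) _ (hmem (k + 1) (by omega)) (hanti (Nat.le_succ k))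
    have h2 : 0 ≤ deriv ψ (s k) * (s k - s (k + 1)) :=
      mul_nonneg (hψp _ (hmem k hk)).le (sub_nonneg.2 (hanti (Nat.le_succ k)))
    linarith
  -- Concavity and nonnegativity do not make `ψ` continuous at `0`, so the limit `l` may be
  -- positive.
  obtain ⟨l, hl⟩ : ∃ l, Tendsto (fun k => ψ (s (k + N₀))) atTop (𝓝 l) := by
    have hA : Antitone fun k => ψ (s (k + N₀)) := antitone_nat_of_succ_le fun k => by
      have := hψanti (k + N₀) (by omega)
      rwa [show k + 1 + N₀ = k + N₀ + 1 by ring]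
    exact ⟨_, tendsto_atTop_ciInf hA ⟨0, by
      rintro _ ⟨k, rfl⟩
      exact hψ0 _ (Set.Ioo_subset_Icc_self (hmem _ (by omega)))⟩⟩
  have hl' : Tendsto (fun k => ψ (s k)) atTop (𝓝 l) := (tendsto_add_atTop_iff_nat N₀).1 hl
  have hle : ∀ k ≥ N₀, l ≤ ψ (s k) := by
    intro k hk
    refine le_of_tendsto hl' (eventually_atTop.2 ⟨k, fun j hj => ?_⟩)
    induction j, hj using Nat.le_induction with
    | base => exact le_rfl
    | succ j hj ih => exact (hψanti j (by omega)).trans ih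
  have hl0 : 0 ≤ l := ge_of_tendsto hl' (eventually_atTop.2 ⟨N₀, fun k hk =>
    hψ0 _ (Set.Ioo_subset_Icc_self (hmem k hk))⟩)
  -- `V` is the potential whose decrease dominates the next step. Subtracting `l` makes it tend to
  -- `0`.
  set V : ℕ → ℝ := fun k => ‖x (k + 1) - x k‖ + b / a * (ψ (s (k + 1)) - l) with hV
  have hba : 0 < b / a := div_pos hb ha
  have hV0 : ∀ k ≥ N₀, 0 ≤ V k := fun k hk => by
    have := hle (k + 1) (by omega)
    have : 0 ≤ ψ (s (k + 1)) - l := by linarith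
    simp only [hV]; positivity
  have hVlim : Tendsto V atTop (𝓝 0) := by
    have h1 : Tendsto (fun k => ψ (s (k + 1)) - l) atTop (𝓝 0) := by
      simpa using (hl'.comp (tendsto_add_atTop_nat 1)).sub_const l
    simpa using hstep.add (h1.const_mul (b / a))
  -- the one-step estimate
  have hone : ∀ k ≥ N₀, x (k + 1) ∈ Metric.ball xs ρ →
      ‖x (k + 2) - x (k + 1)‖ ≤ V k - V (k + 1) := by
    intro k hk hx
    have hm1 := hmem (k + 1) (by omega)
    have hm2 := hmem (k + 2) (by omega)
    have h1 := hKL k hx hm1.1 hm1.2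
    have h2 := hslope _ hm1 _ hm2 (hanti (Nat.le_succ _))
    have h3 := hdesc (k + 1)
    have hd := hψp _ hm1
    set p := ‖x (k + 1) - x k‖ with hp
    set q := ‖x (k + 1 + 1) - x (k + 1)‖ with hq
    set D := deriv ψ (s (k + 1))
    set P := ψ (s (k + 1)) - ψ (s (k + 2)) with hP
    have hp0 : 0 ≤ p := norm_nonneg _
    have hq0 : 0 ≤ q := norm_nonneg _
    have h4 : D * (a * q ^ 2) ≤ P :=
      (mul_le_mul_of_nonneg_left (by linarith [h3]) hd.le).trans h2
    have hP0 : 0 ≤ P := le_trans (by positivity) h4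
    have h5 : q ^ 2 ≤ (b / a * P) * p := by
      have : a * q ^ 2 ≤ b * P * p := by
        calc a * q ^ 2 = 1 * (a * q ^ 2) := by ring
          _ ≤ D * (b * p) * (a * q ^ 2) := by gcongr
          _ = b * p * (D * (a * q ^ 2)) := by ring
          _ ≤ b * p * P := by gcongr
          _ = b * P * p := by ring
      rw [div_mul_eq_mul_div, div_mul_eq_mul_div, le_div_iff₀ ha]
      linarith
    -- The arithmetic-geometric mean inequality applied to `h5`. One copy of `q` goes into `V (k +
    -- 1)`, the other remains as the bound on the step.
    have h6 : 2 * q ≤ p + b / a * P := by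
      have hc : 0 ≤ b / a * P := by positivity
      refine abs_le_of_sq_le_sq' ?_ (by positivity) |>.2
      nlinarith [sq_nonneg (p - b / a * P)]
    have h7 : V k - V (k + 1) = p + b / a * P - q := by
      simp only [hV, hP, hp, hq]; ring
    rw [h7]
    change q ≤ _
    linarith
  -- the sequence stays in the neighbourhood
  obtain ⟨N₁, hN₁⟩ := eventually_atTop.1 (hVlim.eventually (gt_mem_nhds (half_pos hρ)))
  -- Half the radius is for the starting point, half for the remaining length, which is at most `V
  -- N`. The index is shifted because the KL inequality is available at `x (k + 1)`.
  obtain ⟨N, hNx, hN⟩ : ∃ N, x (N + 1) ∈ Metric.ball xs (ρ / 2) ∧ max N₀ N₁ ≤ N := by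
    obtain ⟨n, hn, hn'⟩ := ((hcl.frequently (Metric.ball_mem_nhds xs (half_pos hρ))).and_eventually
      (eventually_ge_atTop (max N₀ N₁ + 1))).exists
    exact ⟨n - 1, by rwa [Nat.sub_add_cancel (by omega)], by omega⟩
  have hNa : N₀ ≤ N := (le_max_left _ _).trans hN
  have hNb : N₁ ≤ N := (le_max_right _ _).trans hN
  have hstay : ∀ k ≥ N, ‖x (k + 1) - x (N + 1)‖ ≤ V N - V k ∧ x (k + 1) ∈ Metric.ball xs ρ := by
    have hin : ∀ k ≥ N, ‖x (k + 1) - x (N + 1)‖ ≤ V N - V k → x (k + 1) ∈ Metric.ball xs ρ := by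
      intro k hk h
      have h1 := hV0 k (by omega)
      have h2 := hN₁ N hNb
      rw [Metric.mem_ball] at hNx ⊢
      have h3 := dist_triangle (x (k + 1)) (x (N + 1)) xs
      rw [dist_eq_norm (x (k + 1)) (x (N + 1))] at h3
      linarith
    intro k hk
    induction k, hk using Nat.le_induction with
    | base => exact ⟨by simp, hin N le_rfl (by simp)⟩
    | succ k hk ih =>
      have h1 := hone k (by omega) ih.2
      have h2 : ‖x (k + 1 + 1) - x (N + 1)‖ ≤ V N - V (k + 1) := by
        have := norm_sub_le_norm_sub_add_norm_sub (x (k + 1 + 1)) (x (k + 1)) (x (N + 1))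
        have h3 := ih.1
        change ‖x (k + 1 + 1) - x (k + 1)‖ ≤ _ at h1
        linarith
      exact ⟨h2, hin _ (by omega) h2⟩
  have htail : ∀ k ≥ N, ∀ j ≥ k, ‖x (j + 1) - x (k + 1)‖ ≤ V k - V j := by
    intro k hk j hj
    induction j, hj using Nat.le_induction with
    | base => simp
    | succ j hj ih =>
      have h1 := hone j (by omega) (hstay j (by omega)).2
      have := norm_sub_le_norm_sub_add_norm_sub (x (j + 1 + 1)) (x (j + 1)) (x (k + 1))
      change ‖x (j + 1 + 1) - x (j + 1)‖ ≤ _ at h1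
      linarith
  have hdist : ∀ k ≥ N, ‖x (k + 1) - xs‖ ≤ V k := by
    intro k hk
    -- So far `xs` is only a cluster point: the tail bound is compared with one late index close to
    -- `xs`.
    refine le_of_forall_pos_le_add fun ε hε => ?_
    obtain ⟨n, hn, hn'⟩ := ((hcl.frequently (Metric.ball_mem_nhds xs hε)).and_eventually
      (eventually_ge_atTop (k + 1))).exists
    have h1 := htail k hk (n - 1) (by omega)
    rw [Nat.sub_add_cancel (by omega : 1 ≤ n)] at h1
    have h2 := hV0 (n - 1) (by omega)
    change dist (x n) xs < ε at hn
    rw [dist_eq_norm] at hn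
    have h3 := norm_sub_le_norm_sub_add_norm_sub (x (k + 1)) (x n) xs
    rw [norm_sub_rev (x (k + 1)) (x n)] at h3
    linarith
  constructor
  · rw [← tendsto_add_atTop_iff_nat 1, tendsto_iff_norm_sub_tendsto_zero]
    exact squeeze_zero' (Eventually.of_forall fun _ => norm_nonneg _)
      (eventually_atTop.2 ⟨N, hdist⟩) hVlim
  · refine ⟨N, fun k hk => (hdist k hk).trans ?_⟩
    have : b / a * (ψ (s (k + 1)) - l) ≤ b / a * ψ (s (k + 1)) := by gcongr; linarith
    simp only [hV]; linarith

end DescentSequence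

/-! ### Convergence rates from the gap recursion -/

section Rates

/-- Finitely many initial terms are absorbed into the constant, so rates proved for large indices
hold for all. -/
lemma exists_pos_forall_le_mul {u v : ℕ → ℝ} (hv : ∀ k, 0 < v k) {N : ℕ} {ω : ℝ}
    (h : ∀ k ≥ N, u k ≤ ω * v k) : ∃ ω' : ℝ, 0 < ω' ∧ ∀ k, u k ≤ ω' * v k := by
  have hS : ∀ j ∈ Finset.range N, 0 ≤ |u j| / v j := fun j _ => by
    have := hv j; positivity
  refine ⟨∑ j ∈ Finset.range N, |u j| / v j + |ω| + 1, ?_, fun k => ?_⟩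
  · have := Finset.sum_nonneg hS; positivity
  rcases le_or_gt N k with hk | hk
  · refine (h k hk).trans (mul_le_mul_of_nonneg_right ?_ (hv k).le)
    have := Finset.sum_nonneg hS
    linarith [le_abs_self ω]
  · have h1 := Finset.single_le_sum hS (Finset.mem_range.2 hk)
    have h2 : |u k| / v k ≤ ∑ j ∈ Finset.range N, |u j| / v j + |ω| + 1 := by
      linarith [abs_nonneg ω]
    rw [div_le_iff₀ (hv k)] at h2
    exact (le_abs_self _).trans h2

variable {E : Type*} [NormedAddCommGroup E] {x : ℕ → E} {s : ℕ → ℝ} {a b c α : ℝ} {xs : E}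

/-- With a constant derivative of `ψ`, a positive gap keeps the step length away from zero, whereas
the steps tend to zero. -/
lemma descent_kl_finite (hs0 : ∀ k, 0 ≤ s k)
    (ha : 0 < a) (hs : Tendsto s atTop (𝓝 0))
    (hdesc : ∀ k, s (k + 1) + a * ‖x (k + 1) - x k‖ ^ 2 ≤ s k)
    (hKL : ∀ᶠ k in atTop, 0 < s (k + 1) → 1 ≤ c * (b * ‖x (k + 1) - x k‖)) :
    ∃ N, s N = 0 := by
  have h1 : Tendsto (fun k => c * (b * ‖x (k + 1) - x k‖)) atTop (𝓝 0) := by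
    simpa using ((descent_step_tendsto_zero ha hs hdesc).const_mul b).const_mul c
  obtain ⟨k, hk, hk'⟩ := (hKL.and (h1.eventually (gt_mem_nhds one_pos))).exists
  refine ⟨k + 1, ?_⟩
  by_contra hne
  exact absurd (hk (lt_of_le_of_ne (hs0 _) (Ne.symm hne))) (not_le.2 hk')

/-- The KL inequality bounds `s (k + 1) ^ α` by `c * b` times the step; squaring, the descent
inequality replaces the squared step by the decrease of the gap. -/
lemma descent_kl_recursion (hs0 : ∀ k, 0 ≤ s k) (ha : 0 < a) (hb : 0 < b) (hc : 0 < c)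
    (hα : 0 < α)
    (hdesc : ∀ k, s (k + 1) + a * ‖x (k + 1) - x k‖ ^ 2 ≤ s k)
    (hKL : ∀ᶠ k in atTop, 0 < s (k + 1) →
      1 ≤ c * s (k + 1) ^ (-α) * (b * ‖x (k + 1) - x k‖)) :
    ∃ C : ℝ, 0 < C ∧ ∀ᶠ k in atTop, s (k + 1) ^ (2 * α) ≤ C * (s k - s (k + 1)) := by
  refine ⟨(c * b) ^ 2 / a, by positivity, ?_⟩
  filter_upwards [hKL] with k hk
  have hsub : a * ‖x (k + 1) - x k‖ ^ 2 ≤ s k - s (k + 1) := by linarith [hdesc k]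
  rcases (hs0 (k + 1)).eq_or_lt with h0 | hpos
  · rw [← h0] at hsub ⊢
    rw [Real.zero_rpow (by positivity)]
    have : 0 ≤ a * ‖x (k + 1) - x k‖ ^ 2 := by positivity
    have h2 : 0 ≤ s k - 0 := by linarith
    positivity
  have h1 := hk hpos
  set p := ‖x (k + 1) - x k‖
  have hp : 0 ≤ p := norm_nonneg _
  have hsα : 0 < s (k + 1) ^ α := Real.rpow_pos_of_pos hpos α
  rw [Real.rpow_neg hpos.le] at h1
  have h2 : s (k + 1) ^ α ≤ c * b * p := by
    calc s (k + 1) ^ α = 1 * s (k + 1) ^ α := by ring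
      _ ≤ c * (s (k + 1) ^ α)⁻¹ * (b * p) * s (k + 1) ^ α := by gcongr
      _ = c * b * p := by field_simp
  have h3 : s (k + 1) ^ (2 * α) = (s (k + 1) ^ α) ^ 2 := by
    rw [mul_comm, Real.rpow_mul hpos.le]; norm_cast
  rw [h3]
  calc (s (k + 1) ^ α) ^ 2 ≤ (c * b * p) ^ 2 := by gcongr
    _ = (c * b) ^ 2 / a * (a * p ^ 2) := by field_simp
    _ ≤ _ := by gcongr

/-- Once the gap is at most `1`, `p ≤ 1` gives `s (k + 1) ≤ s (k + 1) ^ p`, so the gap contracts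
geometrically; the steps, of order the square root of the gap, are then summable. -/
lemma descent_linear_rate (hs0 : ∀ k, 0 ≤ s k) (ha : 0 < a) (hs : Tendsto s atTop (𝓝 0))
    (hx : Tendsto x atTop (𝓝 xs))
    (hdesc : ∀ k, s (k + 1) + a * ‖x (k + 1) - x k‖ ^ 2 ≤ s k)
    {p C : ℝ} (hp : p ≤ 1) (hC : 0 < C)
    (hrec : ∀ᶠ k in atTop, s (k + 1) ^ p ≤ C * (s k - s (k + 1))) :
    ∃ ω τ : ℝ, 0 < ω ∧ 0 ≤ τ ∧ τ < 1 ∧ ∀ k : ℕ, ‖x k - xs‖ ≤ ω * τ ^ k := by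
  have hs1 : ∀ᶠ k in atTop, s (k + 1) ≤ 1 :=
    ((hs.comp (tendsto_add_atTop_nat 1)).eventually (gt_mem_nhds one_pos)).mono fun _ h => le_of_lt h
  obtain ⟨N, hN⟩ := eventually_atTop.1 (hrec.and hs1)
  -- The contraction factor obtained by solving `s (k + 1) ≤ C * (s k - s (k + 1))` for `s (k + 1)`.
  set q : ℝ := C / (1 + C) with hq
  have hq0 : 0 < q := by positivity
  have hq1 : q < 1 := by rw [hq, div_lt_one (by positivity)]; linarith
  have hstep : ∀ k ≥ N, s (k + 1) ≤ q * s k := by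
    intro k hk
    obtain ⟨h1, h2⟩ := hN k hk
    have hdec := descent_gap_antitone ha hdesc (Nat.le_succ k)
    have h3 : s (k + 1) ≤ C * (s k - s (k + 1)) := by
      rcases (hs0 (k + 1)).eq_or_lt with h0 | hpos
      · rw [← h0]
        have := hs0 k
        simp only [sub_zero]
        positivity
      · have := Real.rpow_le_rpow_of_exponent_ge hpos h2 hp
        rw [Real.rpow_one] at this
        exact this.trans h1
    rw [hq, div_mul_eq_mul_div, le_div_iff₀ (by positivity)]
    linarith
  have hgeo : ∀ n, s (n + N) ≤ s N * q ^ n := by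
    intro n
    induction n with
    | zero => simp
    | succ n ih =>
      have h1 := hstep (n + N) (by omega)
      rw [show n + 1 + N = n + N + 1 by ring, pow_succ]
      calc s (n + N + 1) ≤ q * s (n + N) := h1
        _ ≤ q * (s N * q ^ n) := by gcongr
        _ = _ := by ring
  -- By descent, a step is at most `√(s k / a)`, so its ratio is the square root of that of the gap.
  set τ := √q with hτ
  have hτ0 : 0 < τ := Real.sqrt_pos.2 hq0
  have hτ1 : τ < 1 := by rw [hτ, Real.sqrt_lt' one_pos]; simpa using hq1
  have hd : ∀ n, dist (x (n + N)) (x (n + 1 + N)) ≤ √(s N / a) * τ ^ n := by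
    intro n
    rw [dist_comm, dist_eq_norm, show n + 1 + N = n + N + 1 by ring]
    refine abs_le_of_sq_le_sq' ?_ (by positivity) |>.2
    have hsN := hs0 N
    rw [mul_pow, Real.sq_sqrt (by positivity), ← pow_mul, mul_comm n 2, pow_mul, hτ,
      Real.sq_sqrt hq0.le, div_mul_eq_mul_div, le_div_iff₀ ha]
    linarith [hdesc (n + N), hs0 (n + N + 1), hgeo n]
  have hx' : Tendsto (fun n => x (n + N)) atTop (𝓝 xs) := hx.comp (tendsto_add_atTop_nat N)
  have hdist := dist_le_of_le_geometric_of_tendsto τ _ hτ1 hd hx'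
  obtain ⟨ω, hω, h⟩ := exists_pos_forall_le_mul (u := fun k => ‖x k - xs‖) (v := fun k => τ ^ k)
    (fun k => by positivity) (N := N) (ω := √(s N / a) / (1 - τ) / τ ^ N) (fun k hk => by
      have h1 := hdist (k - N)
      rw [Nat.sub_add_cancel hk, dist_eq_norm] at h1
      refine h1.trans (le_of_eq ?_)
      have h2 : τ ^ k = τ ^ (k - N) * τ ^ N := by rw [← pow_add, Nat.sub_add_cancel hk]
      have h3 : 1 - τ ≠ 0 := by linarith
      rw [h2]
      field_simp)
  exact ⟨ω, τ, hω, hτ0.le, hτ1, h⟩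

/-- Discrete counterpart of the fact that `u' = -u ^ p / C` makes `u ^ (-(p - 1))` grow at a
constant rate. If `u ≤ 2 * v`, the two values are comparable and the recursion supplies the
increase; if `u > 2 * v`, the drop itself does. -/
lemma rpow_neg_sub_rpow_neg_ge {u v p C : ℝ} (hv : 0 < v) (hvu : v ≤ u) (hu : u ≤ 1)
    (hp1 : 1 < p) (hp2 : p ≤ 2) (hC : 0 < C) (h : v ^ p ≤ C * (u - v)) :
    min ((p - 1) / (4 * C)) ((p - 1) / 2) ≤ v ^ (-(p - 1)) - u ^ (-(p - 1)) := by
  have hu0 : 0 < u := hv.trans_le hvu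
  set r := p - 1 with hr
  have hr0 : 0 < r := by linarith
  have hur : 0 < u ^ (-r) := Real.rpow_pos_of_pos hu0 _
  -- Write `v ^ (-r)` as `u ^ (-r)` times `exp (r * log (u / v))` and use `1 + x ≤ exp x`.
  have hlog : u ^ (-r) * (r * Real.log (u / v)) ≤ v ^ (-r) - u ^ (-r) := by
    have h1 : v ^ (-r) = u ^ (-r) * Real.exp (r * Real.log (u / v)) := by
      rw [mul_comm r, ← Real.rpow_def_of_pos (by positivity), Real.div_rpow hu0.le hv.le,
        Real.rpow_neg hu0.le, Real.rpow_neg hv.le]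
      have := Real.rpow_pos_of_pos hu0 r
      field_simp
    have h2 := Real.add_one_le_exp (r * Real.log (u / v))
    rw [h1]
    nlinarith
  refine le_trans ?_ hlog
  rcases le_or_gt u (2 * v) with h2 | h2
  · refine (min_le_left _ _).trans ?_
    have h3 : 1 - (u / v)⁻¹ ≤ Real.log (u / v) := Real.one_sub_inv_le_log_of_pos (by positivity)
    have h4 : v ^ p / (C * u) ≤ Real.log (u / v) := by
      refine le_trans ?_ h3
      rw [inv_div, div_le_iff₀ (by positivity)]
      have : (1 - v / u) * (C * u) = C * (u - v) := by field_simp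
      linarith
    have h5 : u ^ (-r) * (r * (v ^ p / (C * u))) = r / C * (v / u) ^ p := by
      have : u ^ p = u ^ r * u := by
        rw [hr, Real.rpow_sub_one hu0.ne']; field_simp
      rw [Real.div_rpow hv.le hu0.le, this, Real.rpow_neg hu0.le]
      have := Real.rpow_pos_of_pos hu0 r
      field_simp
    have h6 : (1 / 4 : ℝ) ≤ (v / u) ^ p := by
      calc (1 / 4 : ℝ) = (1 / 2 : ℝ) ^ (2 : ℝ) := by norm_num
        _ ≤ (v / u) ^ (2 : ℝ) := by
            refine Real.rpow_le_rpow (by norm_num) ?_ zero_le_two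
            rw [div_le_div_iff₀ two_pos hu0]; linarith
        _ ≤ (v / u) ^ p :=
            Real.rpow_le_rpow_of_exponent_ge (by positivity) ((div_le_one hu0).2 hvu) hp2
    calc r / (4 * C) = r / C * (1 / 4) := by field_simp
      _ ≤ r / C * (v / u) ^ p := by gcongr
      _ = u ^ (-r) * (r * (v ^ p / (C * u))) := h5.symm
      _ ≤ _ := by gcongr
  · refine (min_le_right _ _).trans ?_
    have h3 : 1 ≤ u ^ (-r) := Real.one_le_rpow_of_pos_of_le_one_of_nonpos hu0 hu (by linarith)
    have h4 : (1 / 2 : ℝ) ≤ Real.log (u / v) := by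
      have h5 : Real.log 2 ≤ Real.log (u / v) :=
        Real.log_le_log two_pos (by rw [le_div_iff₀ hv]; exact h2.le)
      linarith [Real.log_two_gt_d9]
    calc r / 2 = 1 * (r * (1 / 2)) := by ring
      _ ≤ _ := by gcongr

/-- The power `s k ^ (-(2 * α - 1))` grows at least linearly in `k`, while the distance to the limit
is of order `s k ^ (1 - α)`: the step is of order `√(s k)`, which is no larger since `1 - α < 1 / 2`
and `s k ≤ 1`. -/
lemma descent_sublinear_rate (hs0 : ∀ k, 0 ≤ s k) (ha : 0 < a) (hb : 0 < b) (hc : 0 < c)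
    (hα : 1 / 2 < α) (hα1 : α < 1) (hs : Tendsto s atTop (𝓝 0))
    (hcl : MapClusterPt xs atTop x)
    (hdesc : ∀ k, s (k + 1) + a * ‖x (k + 1) - x k‖ ^ 2 ≤ s k)
    {C : ℝ} (hC : 0 < C)
    (hrec : ∀ᶠ k in atTop, s (k + 1) ^ (2 * α) ≤ C * (s k - s (k + 1)))
    (hdist : ∀ᶠ k in atTop, ‖x (k + 1) - xs‖ ≤
      ‖x (k + 1) - x k‖ + b / a * (c * s (k + 1) ^ (1 - α))) :
    ∃ ω : ℝ, 0 < ω ∧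
      ∀ k : ℕ, 1 ≤ k → ‖x k - xs‖ ≤ ω * (k : ℝ) ^ (-((1 - α) / (2 * α - 1))) := by
  set e : ℝ := (1 - α) / (2 * α - 1) with he
  have he0 : 0 < e := div_pos (by linarith) (by linarith)
  suffices H : ∃ N : ℕ, ∃ ω : ℝ, ∀ k ≥ N, ‖x (k + 1) - xs‖ ≤ ω * ((k : ℝ) + 1) ^ (-e) by
    obtain ⟨N, ω, h⟩ := H
    obtain ⟨ω', hω', h'⟩ := exists_pos_forall_le_mul (u := fun k => ‖x (k + 1) - xs‖)
      (v := fun k : ℕ => ((k : ℝ) + 1) ^ (-e)) (fun k => by positivity) h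
    refine ⟨ω', hω', fun k hk => ?_⟩
    have := h' (k - 1)
    rw [Nat.cast_sub hk] at this
    simpa [Nat.sub_add_cancel hk] using this
  by_cases hz : ∃ N, s N = 0
  · obtain ⟨N, hN⟩ := hz
    refine ⟨N, 0, fun k hk => ?_⟩
    rw [(descent_eq_of_gap_eq_zero ha hs0 hdesc hcl hN (k + 1) (by omega)).1]
    simp
  push Not at hz
  have hpos : ∀ k, 0 < s k := fun k => lt_of_le_of_ne (hs0 k) (hz k).symm
  have hanti := descent_gap_antitone ha hdesc
  have hs1 : ∀ᶠ k in atTop, s k ≤ 1 :=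
    (hs.eventually (gt_mem_nhds one_pos)).mono fun _ h => le_of_lt h
  obtain ⟨N, hN⟩ := eventually_atTop.1 ((hrec.and hs1).and hdist)
  set μ : ℝ := min ((2 * α - 1) / (4 * C)) ((2 * α - 1) / 2) with hμ
  have h2α : 0 < 2 * α - 1 := by linarith
  have hμ0 : 0 < μ := lt_min (by positivity) (by positivity)
  have hinc : ∀ n, μ * n ≤ s (n + N) ^ (-(2 * α - 1)) := by
    intro n
    induction n with
    | zero => simpa using (Real.rpow_pos_of_pos (hpos (0 + N)) _).le
    | succ n ih =>
      have h1 := rpow_neg_sub_rpow_neg_ge (hpos (n + N + 1)) (hanti (Nat.le_succ (n + N)))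
        (hN (n + N) (by omega)).1.2 (by linarith) (by linarith) hC (hN (n + N) (by omega)).1.1
      rw [← hμ] at h1
      rw [show n + 1 + N = n + N + 1 by ring]
      push_cast
      linarith
  have hbound : ∀ k ≥ N, ‖x (k + 1) - xs‖ ≤ (1 / √a + b / a * c) * s k ^ (1 - α) := by
    intro k hk
    refine (hN k hk).2.trans ?_
    have h1 : ‖x (k + 1) - x k‖ ≤ 1 / √a * s k ^ (1 - α) := by
      have h2 : ‖x (k + 1) - x k‖ ≤ √(s k / a) := by
        refine Real.le_sqrt_of_sq_le ?_
        rw [le_div_iff₀ ha]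
        linarith [hdesc k, hs0 (k + 1)]
      refine h2.trans ?_
      rw [Real.sqrt_div (hs0 k), div_eq_mul_one_div, mul_comm, Real.sqrt_eq_rpow (s k)]
      exact mul_le_mul_of_nonneg_left
        (Real.rpow_le_rpow_of_exponent_ge (hpos k) (hN k hk).1.2 (by linarith)) (by positivity)
    have h2 : s (k + 1) ^ (1 - α) ≤ s k ^ (1 - α) :=
      Real.rpow_le_rpow (hs0 _) (hanti (Nat.le_succ k)) (by linarith)
    have h3 : b / a * (c * s (k + 1) ^ (1 - α)) ≤ b / a * (c * s k ^ (1 - α)) := by gcongr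
    linarith
  -- From `2 * N + 1` on, `k - N ≥ (k + 1) / 2`, which accounts for `μ / 2`.
  refine ⟨2 * N + 1, (1 / √a + b / a * c) * (μ / 2) ^ (-e), fun k hk => ?_⟩
  refine (hbound k (by omega)).trans ?_
  rw [mul_assoc, ← Real.mul_rpow (by positivity) (by positivity)]
  refine mul_le_mul_of_nonneg_left ?_ (by positivity)
  have h1 := hinc (k - N)
  rw [Nat.sub_add_cancel (by omega), Nat.cast_sub (by omega)] at h1
  have h2 : μ / 2 * ((k : ℝ) + 1) ≤ s k ^ (-(2 * α - 1)) := by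
    refine le_trans ?_ h1
    have : (2 * N + 1 : ℝ) ≤ k := by exact_mod_cast hk
    nlinarith
  have h3 : s k ^ (1 - α) = (s k ^ (-(2 * α - 1))) ^ (-e) := by
    rw [← Real.rpow_mul (hs0 k)]
    congr 1
    rw [he, neg_mul_neg, mul_div_cancel₀ _ h2α.ne']
  rw [h3]
  exact Real.rpow_le_rpow_of_nonpos (by positivity) h2 (by linarith)

end Rates

/-! ### Majorization-minimization steps on a compact set -/

lemma exists_lipschitzOnWith_mul {E : Type*} [NormedAddCommGroup E] {S : Set E} {u v : E → ℝ} (hS : IsCompact S)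
    (hu : ∃ C : NNReal, LipschitzOnWith C u S) (hv : ∃ C : NNReal, LipschitzOnWith C v S) :
    ∃ C : NNReal, LipschitzOnWith C (fun x => u x * v x) S := by
  obtain ⟨C₁, h₁⟩ := hu
  obtain ⟨C₂, h₂⟩ := hv
  obtain ⟨M₁, hM₁⟩ := hS.exists_bound_of_continuousOn h₁.continuousOn
  obtain ⟨M₂, hM₂⟩ := hS.exists_bound_of_continuousOn h₂.continuousOn
  refine ⟨Real.toNNReal (|M₁| * C₂ + C₁ * |M₂|), LipschitzOnWith.of_dist_le_mul ?_⟩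
  intro x hx y hy
  rw [Real.coe_toNNReal _ (by positivity), dist_eq_norm, dist_eq_norm]
  have e1 := h₁.norm_sub_le hx hy
  have e2 := h₂.norm_sub_le hx hy
  have b1 := (hM₁ x hx).trans (le_abs_self _)
  have b2 := (hM₂ y hy).trans (le_abs_self _)
  calc ‖u x * v x - u y * v y‖ = ‖u x * (v x - v y) + (u x - u y) * v y‖ := by ring_nf
    _ ≤ ‖u x‖ * ‖v x - v y‖ + ‖u x - u y‖ * ‖v y‖ := by
        rw [← norm_mul, ← norm_mul]; exact norm_add_le _ _
    _ ≤ |M₁| * (C₂ * ‖x - y‖) + (C₁ * ‖x - y‖) * |M₂| := by gcongr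
    _ = _ := by ring

section Majorization

variable {E : Type*} [NormedAddCommGroup E] [NormedSpace ℝ E]

/-- Strict positivity of the Hessian on an open convex set gives uniform convexity along the
segments joining the points of a compact subset. -/
lemma exists_uniformly_convex_of_hess_pos [FiniteDimensional ℝ E] {D S : Set E} {R : E → ℝ}
    (hD : IsOpen D) (hDc : Convex ℝ D) (hS : IsCompact S) (hSD : S ⊆ D)
    (hR : ContDiffOn ℝ 2 R D)
    (hpos : ∀ x ∈ D, ∀ v : E, v ≠ 0 → 0 < fderiv ℝ (fderiv ℝ R) x v v) :
    ∃ μ : ℝ, 0 < μ ∧ ∀ x ∈ S, ∀ y ∈ S, ∀ t ∈ Set.Icc (0 : ℝ) 1,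
      R (x + t • (y - x)) ≤ (1 - t) * R x + t * R y - μ * (t * (1 - t)) * ‖y - x‖ ^ 2 := by
  have hR1 : ContDiffOn ℝ 1 (fderiv ℝ R) D := by
    refine hR.fderiv_of_isOpen hD ?_
    norm_num
  have hd1 : ∀ x ∈ D, HasFDerivAt R (fderiv ℝ R x) x := fun x hx =>
    ((hR.differentiableOn (by norm_num)).differentiableAt (hD.mem_nhds hx)).hasFDerivAt
  have hd2 : ∀ x ∈ D, HasFDerivAt (fderiv ℝ R) (fderiv ℝ (fderiv ℝ R) x) x := fun x hx =>
    ((hR1.differentiableOn (by norm_num)).differentiableAt (hD.mem_nhds hx)).hasFDerivAt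
  have hcont : ContinuousOn (fderiv ℝ (fderiv ℝ R)) D :=
    hR1.continuousOn_fderiv_of_isOpen hD le_rfl
  -- `S` need not be convex, so the Hessian is bounded below on the compact union of all segments
  -- between its points.
  set K : Set E := (fun p : (E × E) × ℝ => p.1.1 + p.2 • (p.1.2 - p.1.1)) ''
    ((S ×ˢ S) ×ˢ Set.Icc 0 1) with hK
  have hKc : IsCompact K := ((hS.prod hS).prod isCompact_Icc).image (by fun_prop)
  have hline : ∀ x ∈ D, ∀ y ∈ D, ∀ t ∈ Set.Icc (0 : ℝ) 1, x + t • (y - x) ∈ D := by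
    intro x hx y hy t ht
    exact hDc.add_smul_sub_mem hx hy ht
  have hKD : K ⊆ D := by
    rintro _ ⟨⟨⟨x, y⟩, t⟩, ⟨⟨hx, hy⟩, ht⟩, rfl⟩
    exact hline x (hSD hx) y (hSD hy) t ht
  obtain ⟨μ, hμ, hbound⟩ : ∃ μ : ℝ, 0 < μ ∧ ∀ x ∈ K, ∀ v : E,
      μ * ‖v‖ ^ 2 ≤ fderiv ℝ (fderiv ℝ R) x v v := by
    have hC : IsCompact (K ×ˢ Metric.sphere (0 : E) 1) := hKc.prod (isCompact_sphere 0 1)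
    have hcontq : ContinuousOn (fun p : E × E => fderiv ℝ (fderiv ℝ R) p.1 p.2 p.2)
        (K ×ˢ Metric.sphere (0 : E) 1) := by
      have h1 : ContinuousOn (fun p : E × E => fderiv ℝ (fderiv ℝ R) p.1)
          (K ×ˢ Metric.sphere (0 : E) 1) :=
        (hcont.mono hKD).comp continuousOn_fst fun p hp => hp.1
      exact (h1.clm_apply continuousOn_snd).clm_apply continuousOn_snd
    obtain ⟨μ, hμ, h⟩ : ∃ μ : ℝ, 0 < μ ∧ ∀ p ∈ K ×ˢ Metric.sphere (0 : E) 1,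
        μ ≤ fderiv ℝ (fderiv ℝ R) p.1 p.2 p.2 := by
      rcases (K ×ˢ Metric.sphere (0 : E) 1).eq_empty_or_nonempty with he | hne
      · exact ⟨1, one_pos, by simp [he]⟩
      · obtain ⟨p, hp, hmin⟩ := hC.exists_isMinOn hne hcontq
        refine ⟨_, hpos p.1 (hKD hp.1) p.2 ?_, fun q hq => hmin hq⟩
        have := hp.2
        rintro h0
        simp [h0] at this
    refine ⟨μ, hμ, fun x hx v => ?_⟩
    rcases eq_or_ne v 0 with rfl | hv
    · simp
    have hn : 0 < ‖v‖ := norm_pos_iff.2 hv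
    have h1 := h (x, ‖v‖⁻¹ • v) ⟨hx, by simp [norm_smul, hn.ne']⟩
    simp only [map_smul, smul_apply, smul_eq_mul] at h1
    have h2 : μ * ‖v‖ ^ 2 ≤ (‖v‖⁻¹ * (‖v‖⁻¹ * fderiv ℝ (fderiv ℝ R) x v v)) * ‖v‖ ^ 2 := by
      gcongr
    refine h2.trans (le_of_eq ?_)
    field_simp
  refine ⟨μ / 2, by positivity, fun x hx y hy => ?_⟩
  have hx' := hSD hx
  have hy' := hSD hy
  set ℓ : ℝ → E := fun t => x + t • (y - x) with hℓ
  have hℓd : ∀ t, HasDerivAt ℓ (y - x) t := fun t => by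
    have h := ((hasDerivAt_id t).smul_const (y - x)).const_add x
    rw [one_smul] at h
    exact h
  have hφ1 : ∀ t ∈ Set.Icc (0 : ℝ) 1, HasDerivAt (fun t => R (ℓ t) - μ / 2 * ‖y - x‖ ^ 2 * t ^ 2)
      (fderiv ℝ R (ℓ t) (y - x) - μ * ‖y - x‖ ^ 2 * t) t := by
    intro t ht
    have h1 := (hd1 _ (hline x hx' y hy' t ht)).comp_hasDerivAt t (hℓd t)
    have h2 := (hasDerivAt_pow 2 t).const_mul (μ / 2 * ‖y - x‖ ^ 2)
    refine (h1.sub h2).congr_deriv ?_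
    norm_num
    ring
  have hφ2 : ∀ t ∈ Set.Icc (0 : ℝ) 1,
      HasDerivAt (fun t => fderiv ℝ R (ℓ t) (y - x) - μ * ‖y - x‖ ^ 2 * t)
      (fderiv ℝ (fderiv ℝ R) (ℓ t) (y - x) (y - x) - μ * ‖y - x‖ ^ 2) t := by
    intro t ht
    have h0 := (hd2 _ (hline x hx' y hy' t ht)).comp_hasDerivAt t (hℓd t)
    have h1 : HasDerivAt (fun t => fderiv ℝ R (ℓ t) (y - x))
        (fderiv ℝ (fderiv ℝ R) (ℓ t) (y - x) (y - x)) t :=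
      (ContinuousLinearMap.apply ℝ ℝ (y - x)).hasFDerivAt.comp_hasDerivAt t h0
    have h2 := (hasDerivAt_id t).const_mul (μ * ‖y - x‖ ^ 2)
    refine (h1.sub h2).congr_deriv ?_
    rw [mul_one]
  -- Subtracting the quadratic with second derivative `μ * ‖y - x‖ ^ 2` leaves a convex function;
  -- its chord inequality gives the modulus `μ / 2`.
  have hconv : ConvexOn ℝ (Set.Icc 0 1) (fun t => R (ℓ t) - μ / 2 * ‖y - x‖ ^ 2 * t ^ 2) := by
    refine convexOn_of_hasDerivWithinAt2_nonneg (convex_Icc 0 1)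
      (fun t ht => (hφ1 t ht).continuousAt.continuousWithinAt)
      (fun t ht => (hφ1 t (interior_subset ht)).hasDerivWithinAt)
      (fun t ht => (hφ2 t (interior_subset ht)).hasDerivWithinAt) (fun t ht => ?_)
    have := hbound (ℓ t) ⟨⟨⟨x, y⟩, t⟩, ⟨⟨hx, hy⟩, interior_subset ht⟩, rfl⟩ (y - x)
    linarith
  intro t ht
  have h := hconv.2 (Set.left_mem_Icc.2 zero_le_one) (Set.right_mem_Icc.2 zero_le_one)
    (sub_nonneg.2 ht.2) ht.1 (by ring)
  simp only [hℓ, smul_eq_mul, mul_zero, mul_one, zero_add, zero_smul, add_zero, one_smul,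
    add_sub_cancel] at h
  nlinarith [h]

/-- Quadratic growth at a minimizer of the sum of a convex and a uniformly convex function. -/
lemma quadratic_growth_of_isMinOn {D : Set E} {P R : E → ℝ} {μ : ℝ} {x y : E}
    (hP : ConvexOn ℝ D P) (hx : x ∈ D) (hy : y ∈ D)
    (hR : ∀ t ∈ Set.Icc (0 : ℝ) 1,
      R (x + t • (y - x)) ≤ (1 - t) * R x + t * R y - μ * (t * (1 - t)) * ‖y - x‖ ^ 2)
    (hmin : IsMinOn (fun z => P z + R z) D x) :
    P x + R x + μ * ‖y - x‖ ^ 2 ≤ P y + R y := by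
  -- Compare `x` with the point at parameter `t` on the segment and divide by `t`; letting `t` tend
  -- to `0` recovers the full constant `μ`.
  have key : ∀ t ∈ Set.Ioo (0 : ℝ) 1,
      P x + R x + μ * (1 - t) * ‖y - x‖ ^ 2 ≤ P y + R y := by
    intro t ht
    have ht' : t ∈ Set.Icc (0 : ℝ) 1 := Set.Ioo_subset_Icc_self ht
    have h1 : P x + R x ≤ P (x + t • (y - x)) + R (x + t • (y - x)) :=
      hmin (hP.1.add_smul_sub_mem hx hy ht')
    have h2 := hP.2 hx hy (sub_nonneg.2 ht'.2) ht'.1 (by ring)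
    rw [show (1 - t) • x + t • y = x + t • (y - x) by module] at h2
    simp only [smul_eq_mul] at h2
    have h3 := hR t ht'
    have h4 : t * (P x + R x + μ * (1 - t) * ‖y - x‖ ^ 2) ≤ t * (P y + R y) := by nlinarith
    exact le_of_mul_le_mul_left h4 ht.1
  have hlim : Tendsto (fun t : ℝ => P x + R x + μ * (1 - t) * ‖y - x‖ ^ 2) (𝓝[>] 0)
      (𝓝 (P x + R x + μ * (1 - 0) * ‖y - x‖ ^ 2)) := by
    refine (Continuous.tendsto ?_ 0).mono_left nhdsWithin_le_nhds
    fun_prop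
  have := le_of_tendsto hlim
    (eventually_of_mem (Ioo_mem_nhdsGT one_pos) key)
  simpa using this

variable {J : Type*} [Fintype J] {D S : Set E} {A G : J → E → ℝ} {L R : E → ℝ}

/-- The regularized loss decreases sufficiently along majorization-minimization steps. -/
lemma majorization_sufficient_decrease [FiniteDimensional ℝ E] (hD : IsOpen D)
    (hDc : Convex ℝ D) (hS : IsCompact S) (hSD : S ⊆ D) (hR : ContDiffOn ℝ 2 R D)
    (hpos : ∀ x ∈ D, ∀ v : E, v ≠ 0 → 0 < fderiv ℝ (fderiv ℝ R) x v v)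
    (hA : ∀ j, ∀ x ∈ D, 0 ≤ A j x) (hG : ∀ j, ConvexOn ℝ D (G j))
    (hmaj : ∀ x₀ ∈ D, ∀ x ∈ D,
      L x ≤ L x₀ + ∑ j, A j x₀ * (G j x - G j x₀) + (R x - R x₀)) :
    ∃ a : ℝ, 0 < a ∧ ∀ x₀ ∈ S, ∀ x₁ ∈ S,
      IsMinOn (fun x => ∑ j, A j x₀ * G j x + R x) D x₁ → L x₁ + a * ‖x₁ - x₀‖ ^ 2 ≤ L x₀ := by
  obtain ⟨μ, hμ, h⟩ := exists_uniformly_convex_of_hess_pos hD hDc hS hSD hR hpos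
  refine ⟨μ, hμ, fun x₀ h₀ x₁ h₁ hmin => ?_⟩
  have hP : ConvexOn ℝ D (fun x => ∑ j, A j x₀ * G j x) := by
    have := Finset.univ.sum_induction (fun j => fun x => A j x₀ * G j x) (ConvexOn ℝ D)
      (fun _ _ => ConvexOn.add) (convexOn_const 0 hDc)
      (fun j _ => (hG j).smul (hA j x₀ (hSD h₀)))
    convert this using 1
    ext x; simp
  have h1 := quadratic_growth_of_isMinOn hP (hSD h₁) (hSD h₀) (h x₁ h₁ x₀ h₀) hmin
  have h2 := hmaj x₀ (hSD h₀) x₁ (hSD h₁)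
  simp only [mul_sub, Finset.sum_sub_distrib] at h2
  rw [norm_sub_rev] at h1
  linarith

/-- The derivative of the loss at a majorization-minimization step is controlled by its length. -/
lemma majorization_relative_error (hD : IsOpen D) (hS : IsCompact S) (hSD : S ⊆ D)
    (hR : DifferentiableOn ℝ R D) (hL : DifferentiableOn ℝ L D)
    (hA : ∀ j, ∃ C : NNReal, LipschitzOnWith C (A j) S) (hG : ∀ j, ContDiffOn ℝ 1 (G j) D)
    (hmaj : ∀ x₀ ∈ D, ∀ x ∈ D,
      L x ≤ L x₀ + ∑ j, A j x₀ * (G j x - G j x₀) + (R x - R x₀)) :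
    ∃ b : ℝ, 0 < b ∧ ∀ x₀ ∈ S, ∀ x₁ ∈ S,
      IsMinOn (fun x => ∑ j, A j x₀ * G j x + R x) D x₁ → ‖fderiv ℝ L x₁‖ ≤ b * ‖x₁ - x₀‖ := by
  choose C hC using hA
  have hM : ∀ j, ∃ M : ℝ, ∀ x ∈ S, ‖fderiv ℝ (G j) x‖ ≤ M := fun j =>
    hS.exists_bound_of_continuousOn
      (((hG j).continuousOn_fderiv_of_isOpen hD le_rfl).mono hSD)
  choose M hM using hM
  have hsum : 0 ≤ ∑ j, (C j : ℝ) * |M j| := Finset.sum_nonneg fun j _ => by positivity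
  refine ⟨∑ j, (C j : ℝ) * |M j| + 1, by positivity, fun x₀ h₀ x₁ h₁ hmin => ?_⟩
  have hx₁ := hSD h₁
  have hnhds := hD.mem_nhds hx₁
  have hGd : ∀ j, HasFDerivAt (G j) (fderiv ℝ (G j) x₁) x₁ := fun j =>
    (((hG j).differentiableOn (by norm_num)).differentiableAt hnhds).hasFDerivAt
  have hRd := (hR.differentiableAt hnhds).hasFDerivAt
  have hLd := (hL.differentiableAt hnhds).hasFDerivAt
  have hF : ∀ x, HasFDerivAt (fun z => ∑ j, A j x * G j z + R z)
      (∑ j, A j x • fderiv ℝ (G j) x₁ + fderiv ℝ R x₁) x₁ := fun x =>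
    (HasFDerivAt.fun_sum fun j _ => (hGd j).const_mul (A j x)).add hRd
  have hstat : ∑ j, A j x₀ • fderiv ℝ (G j) x₁ + fderiv ℝ R x₁ = 0 :=
    (hmin.isLocalMin hnhds).hasFDerivAt_eq_zero (hF x₀)
  -- The surrogate built at `x₁` itself minus the loss is locally minimal at `x₁`, so the two have
  -- the same derivative there.
  have htouch : ∑ j, A j x₁ • fderiv ℝ (G j) x₁ + fderiv ℝ R x₁ - fderiv ℝ L x₁ = 0 := by
    refine IsLocalMin.hasFDerivAt_eq_zero (f := fun z => ∑ j, A j x₁ * G j z + R z - L z)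
      ?_ ((hF x₁).sub hLd)
    filter_upwards [hnhds] with z hz
    have := hmaj x₁ hx₁ z hz
    simp only [mul_sub, Finset.sum_sub_distrib] at this
    linarith
  -- Both identities use derivatives at `x₁`, so the regularizer cancels and only the coefficients
  -- differ; bounded derivatives of `G j` suffice.
  have heq : fderiv ℝ L x₁ = ∑ j, (A j x₁ - A j x₀) • fderiv ℝ (G j) x₁ := by
    simp only [sub_smul, Finset.sum_sub_distrib]
    rw [← sub_eq_zero.1 htouch, eq_neg_of_add_eq_zero_right hstat]
    abel
  rw [heq]
  calc ‖∑ j, (A j x₁ - A j x₀) • fderiv ℝ (G j) x₁‖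
      ≤ ∑ j, ‖(A j x₁ - A j x₀) • fderiv ℝ (G j) x₁‖ := norm_sum_le _ _
    _ ≤ ∑ j, (C j : ℝ) * |M j| * ‖x₁ - x₀‖ := by
        refine Finset.sum_le_sum fun j _ => ?_
        rw [norm_smul]
        have h1 := (hC j).norm_sub_le h₁ h₀
        have h2 := (hM j x₁ h₁).trans (le_abs_self _)
        calc ‖A j x₁ - A j x₀‖ * ‖fderiv ℝ (G j) x₁‖ ≤ (C j * ‖x₁ - x₀‖) * |M j| := by gcongr
          _ = _ := by ring
    _ ≤ _ := by
        rw [← Finset.sum_mul]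
        gcongr
        linarith

lemma exists_lipschitzOnWith_of_contDiffOn {h : E → ℝ} (hDc : Convex ℝ D) (hS : IsCompact S)
    (hSD : S ⊆ D) (hh : ContDiffOn ℝ 1 h D) : ∃ C : NNReal, LipschitzOnWith C h S :=
  ((hh.locallyLipschitzOn hDc).mono hSD).exists_lipschitzOnWith_of_compact hS

end Majorization

/-! ### Log-sum-exp -/

/-- Jensen's inequality for weighted log-sum-exp functions. -/
lemma neg_log_sum_exp_le {ι : Type*} [Fintype ι] {w : ι → ℝ} (hw : ∀ i, 0 ≤ w i) (h h₀ : ι → ℝ)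
    (hpos : 0 < ∑ i, w i * Real.exp (-h₀ i)) :
    -Real.log (∑ i, w i * Real.exp (-h i)) ≤ -Real.log (∑ i, w i * Real.exp (-h₀ i)) +
      ∑ i, w i * Real.exp (-h₀ i) / (∑ j, w j * Real.exp (-h₀ j)) * (h i - h₀ i) := by
  set W := ∑ i, w i * Real.exp (-h₀ i) with hW
  set π : ι → ℝ := fun i => w i * Real.exp (-h₀ i) / W with hπ
  have hπ0 : ∀ i ∈ Finset.univ, 0 ≤ π i := fun i _ =>
    div_nonneg (mul_nonneg (hw i) (Real.exp_pos _).le) hpos.le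
  have hπ1 : ∑ i, π i = 1 := by
    rw [hπ, ← Finset.sum_div, ← hW, div_self hpos.ne']
  have hJ := convexOn_exp.map_sum_le (p := fun i => h₀ i - h i) hπ0 hπ1 (fun _ _ => Set.mem_univ _)
  simp only [smul_eq_mul] at hJ
  have hR : ∑ i, π i * Real.exp (h₀ i - h i) = (∑ i, w i * Real.exp (-h i)) / W := by
    rw [Finset.sum_div]
    refine Finset.sum_congr rfl fun i _ => ?_
    have : Real.exp (-h i) = Real.exp (-h₀ i) * Real.exp (h₀ i - h i) := by
      rw [← Real.exp_add]; ring_nf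
    rw [hπ, this]; ring
  rw [hR] at hJ
  have hpos' : 0 < ∑ i, w i * Real.exp (-h i) := by
    have := (Real.exp_pos _).trans_le hJ
    exact (div_pos_iff_of_pos_right hpos).1 this
  have hlog := (Real.le_log_iff_exp_le (div_pos hpos' hpos)).2 hJ
  rw [Real.log_div hpos'.ne' hpos.ne'] at hlog
  have hneg : ∑ i, π i * (h i - h₀ i) = -∑ i, π i * (h₀ i - h i) := by
    rw [← Finset.sum_neg_distrib]
    exact Finset.sum_congr rfl fun i _ => by ring
  change _ ≤ _ + ∑ i, π i * (h i - h₀ i)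
  rw [hneg]
  linarith

/-- Jensen's bound with unit weights is the supporting hyperplane inequality, with slope the softmax
at the intermediate point; in the convex combination of its instances at the endpoints the linear
terms cancel. -/
lemma convexOn_lse {ι : Type*} [Fintype ι] [Nonempty ι] :
    ConvexOn ℝ Set.univ (lse : (ι → ℝ) → ℝ) := by
  refine ⟨convex_univ, fun x _ y _ a b ha hb hab => ?_⟩
  set u := a • x + b • y with hu
  have hpos : 0 < ∑ i : ι, (1 : ℝ) * Real.exp (-(-u i)) :=
    Finset.sum_pos (fun i _ => by positivity) Finset.univ_nonempty
  have key : ∀ v : ι → ℝ, lse u + ∑ i, softmax u i * (v i - u i) ≤ lse v := by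
    intro v
    have := neg_log_sum_exp_le (w := fun _ => 1) (fun _ => zero_le_one) (fun i => -v i)
      (fun i => -u i) hpos
    simp only [neg_neg, one_mul] at this
    have h2 : ∑ i, Real.exp (u i) / (∑ j, Real.exp (u j)) * (-v i - -u i)
        = -∑ i, softmax u i * (v i - u i) := by
      rw [← Finset.sum_neg_distrib]
      exact Finset.sum_congr rfl fun i _ => by rw [softmax]; ring
    rw [h2] at this
    unfold lse
    linarith
  have hx := mul_le_mul_of_nonneg_left (key x) ha
  have hy := mul_le_mul_of_nonneg_left (key y) hb
  have hzero : a * ∑ i, softmax u i * (x i - u i) + b * ∑ i, softmax u i * (y i - u i) = 0 := by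
    rw [Finset.mul_sum, Finset.mul_sum, ← Finset.sum_add_distrib]
    refine Finset.sum_eq_zero fun i _ => ?_
    have : a * (x i - u i) + b * (y i - u i) = 0 := by
      simp only [hu, Pi.add_apply, Pi.smul_apply, smul_eq_mul]
      have : b = 1 - a := by linarith
      rw [this]; ring
    linear_combination softmax u i * this
  simp only [smul_eq_mul]
  have : lse u = a * lse u + b * lse u := by rw [← add_mul, hab, one_mul]
  linarith

lemma softmax_eq_exp {ι : Type*} [Fintype ι] [Nonempty ι] (x : ι → ℝ) (i : ι) :
    softmax x i = Real.exp (x i - lse x) := by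
  have : 0 < ∑ j, Real.exp (x j) :=
    Finset.sum_pos (fun i _ => Real.exp_pos _) Finset.univ_nonempty
  rw [softmax, lse, Real.exp_sub, Real.exp_log this]

/-- A differentiable concave function lies below its tangents. -/
lemma concaveOn_le_tangent {S : Set ℝ} {f : ℝ → ℝ} (hf : ConcaveOn ℝ S f) {x y : ℝ}
    (hx : x ∈ S) (hy : y ∈ S) (hd : DifferentiableAt ℝ f x) :
    f y - f x ≤ deriv f x * (y - x) := by
  rcases lt_trichotomy x y with h | rfl | h
  · have := hf.slope_le_deriv hx hy h hd
    rwa [slope_def_field, div_le_iff₀ (sub_pos.2 h)] at this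
  · simp
  · have := hf.deriv_le_slope hy hx h hd
    rw [slope_def_field, le_div_iff₀ (sub_pos.2 h)] at this
    linarith

/-! ### The likelihood as a weighted sum of exponentials -/

namespace SwitchingModel

variable {d ny nz ty T : ℕ} {B : Type*}

/-- The parameter-independent weight of a mode sequence. -/
def weight (m : SwitchingModel d ny nz ty T B) (ξ : Fin (T + 1) → Fin d) : ℝ :=
  m.p0 (ξ 0) * ∏ t : Fin T, m.C (m.y ((t : ℤ) + 1)) (m.z t)

variable {m : SwitchingModel d ny nz ty T B} {R₁ : SwitchParam d nz → ℝ} {R₂ : SubsysParam d B → ℝ}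

lemma WellPosed.nonempty (hm : m.WellPosed) : Nonempty (Fin d) :=
  ⟨hm.p0_pos.choose⟩

lemma WellPosed.weight_nonneg (hm : m.WellPosed) (ξ : Fin (T + 1) → Fin d) : 0 ≤ m.weight ξ :=
  mul_nonneg (hm.p0_nonneg _) (Finset.prod_nonneg fun _ _ => (hm.C_pos _ _).le)

lemma WellPosed.exists_weight_pos (hm : m.WellPosed) : ∃ ξ, 0 < m.weight ξ := by
  obtain ⟨i, hi⟩ := hm.p0_pos
  exact ⟨fun _ => i, mul_pos hi (Finset.prod_pos fun _ _ => hm.C_pos _ _)⟩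

lemma WellPosed.sum_weight_exp_pos (hm : m.WellPosed) (h : (Fin (T + 1) → Fin d) → ℝ) :
    0 < ∑ ξ, m.weight ξ * Real.exp (-h ξ) := by
  obtain ⟨ξ, hξ⟩ := hm.exists_weight_pos
  exact Finset.sum_pos' (fun ξ _ => mul_nonneg (hm.weight_nonneg ξ) (Real.exp_pos _).le)
    ⟨ξ, Finset.mem_univ _, mul_pos hξ (Real.exp_pos _)⟩

/-- A softmax factor is the exponential of a score minus a log-sum-exp, so all parameter dependence
moves into one exponent, the form required by `neg_log_sum_exp_le`. -/
lemma WellPosed.joint_eq (hm : m.WellPosed) (θ : Param d nz B) (ξ : Fin (T + 1) → Fin d) :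
    m.joint θ ξ = m.weight ξ * Real.exp (-(m.Psi ξ θ.fst + m.Phi ξ θ.snd)) := by
  have := hm.nonempty
  rw [joint, weight, mul_assoc, Psi, Phi, ← Finset.sum_add_distrib, ← Finset.sum_neg_distrib,
    Real.exp_sum, ← Finset.prod_mul_distrib]
  congr 1
  refine Finset.prod_congr rfl fun t _ => ?_
  rw [subsysDensity, switchProb, softmax_eq_exp, mul_assoc, ← Real.exp_add]
  ring_nf

lemma WellPosed.sum_joint_pos (hm : m.WellPosed) (θ : Param d nz B) : 0 < ∑ ξ, m.joint θ ξ := by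
  simp only [hm.joint_eq]
  exact hm.sum_weight_exp_pos _

lemma WellPosed.posterior_nonneg (hm : m.WellPosed) (θ : Param d nz B)
    (ξ : Fin (T + 1) → Fin d) : 0 ≤ m.posterior θ ξ := by
  refine div_nonneg ?_ (hm.sum_joint_pos θ).le
  rw [hm.joint_eq]
  exact mul_nonneg (hm.weight_nonneg ξ) (Real.exp_pos _).le

/-- The EM majorization of the negative log-likelihood. -/
lemma WellPosed.nll_le (hm : m.WellPosed) (θ θ₀ : Param d nz B) :
    m.nll θ ≤ m.nll θ₀ + ∑ ξ, m.posterior θ₀ ξ *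
      ((m.Psi ξ θ.fst + m.Phi ξ θ.snd) - (m.Psi ξ θ₀.fst + m.Phi ξ θ₀.snd)) := by
  simp only [nll, posterior, hm.joint_eq]
  exact neg_log_sum_exp_le hm.weight_nonneg (fun ξ => m.Psi ξ θ.fst + m.Phi ξ θ.snd)
    (fun ξ => m.Psi ξ θ₀.fst + m.Phi ξ θ₀.snd) (hm.sum_weight_exp_pos _)

lemma extRegLoss_of_mem {θ : Param d nz B} (hθ : θ ∈ m.domθ) :
    m.extRegLoss R₁ R₂ θ = (m.regLoss R₁ R₂ θ : EReal) := if_pos hθ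

lemma IsEMSequence.mem_domθ {θ : ℕ → Param d nz B} (hθ : m.IsEMSequence R₁ R₂ θ) :
    ∀ k, θ k ∈ m.domθ
  | 0 => hθ.init_mem
  | k + 1 => hθ.subsys_mem k

lemma contDiff_switchScore {n : WithTop ℕ∞} (i j : Fin d) (z : EuclideanSpace ℝ (Fin nz)) :
    ContDiff ℝ n (fun Θ : SwitchParam d nz => switchScore Θ i z j) := by
  unfold switchScore; fun_prop

lemma contDiff_Psi [Nonempty (Fin d)] {n : WithTop ℕ∞} (m : SwitchingModel d ny nz ty T B)
    (ξ : Fin (T + 1) → Fin d) : ContDiff ℝ n (m.Psi ξ) := by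
  unfold Psi lse
  refine ContDiff.sum fun t _ => ContDiff.sub (ContDiff.log ?_ fun Θ => ?_)
    (contDiff_switchScore _ _ _)
  · exact ContDiff.sum fun j _ => (contDiff_switchScore _ _ _).exp
  · exact (Finset.sum_pos (fun i _ => Real.exp_pos _) Finset.univ_nonempty).ne'

lemma convexOn_Psi [Nonempty (Fin d)] (m : SwitchingModel d ny nz ty T B)
    (ξ : Fin (T + 1) → Fin d) : ConvexOn ℝ Set.univ (m.Psi ξ) := by
  refine ⟨convex_univ, fun x _ y _ a b ha hb hab => ?_⟩
  have hlin : ∀ i z, switchScore (a • x + b • y) i z =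
      a • switchScore x i z + b • switchScore y i z := by
    intro i z
    ext j
    simp only [switchScore, PiLp.add_apply, PiLp.smul_apply, smul_eq_mul, Pi.add_apply,
      Pi.smul_apply, Finset.mul_sum, ← Finset.sum_add_distrib]
    exact Finset.sum_congr rfl fun _ _ => by ring
  simp only [Psi, smul_eq_mul, Finset.mul_sum, ← Finset.sum_add_distrib]
  refine Finset.sum_le_sum fun t _ => ?_
  rw [hlin]
  have := convexOn_lse.2 (Set.mem_univ (switchScore x (ξ t.castSucc) (m.z t)))
    (Set.mem_univ (switchScore y (ξ t.castSucc) (m.z t))) ha hb hab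
  simp only [smul_eq_mul] at this
  simp only [Pi.add_apply, Pi.smul_apply, smul_eq_mul]
  linarith

/-! ### The surrogate as a combination of convex functions -/

/-- The coefficients, depending on the current iterate, of the surrogate. -/
def surrogateCoeff (m : SwitchingModel d ny nz ty T B) :
    (Fin (T + 1) → Fin d) ⊕ (Fin (T + 1) → Fin d) × Fin T → Param d nz B → ℝ
  | .inl ξ, θ => m.posterior θ ξ
  | .inr (ξ, t), θ => m.posterior θ ξ * deriv m.f (m.ellAt t (θ.snd (ξ t.succ)))

/-- The functions whose combination is the surrogate. -/
def surrogateTerm (m : SwitchingModel d ny nz ty T B) :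
    (Fin (T + 1) → Fin d) ⊕ (Fin (T + 1) → Fin d) × Fin T → Param d nz B → ℝ
  | .inl ξ, θ => m.Psi ξ θ.fst + ∑ t : Fin T, m.gAt t (θ.snd (ξ t.succ))
  | .inr (ξ, t), θ => m.ellAt t (θ.snd (ξ t.succ))

/-- The surrogate splits into a part in `Θ` and a part in `β`, over a product domain, so the two
separate minimizations amount to one joint minimization. -/
lemma IsEMSequence.isMinOn_surrogate {θ : ℕ → Param d nz B} (hθ : m.IsEMSequence R₁ R₂ θ) (k : ℕ) :
    IsMinOn (fun ϑ => ∑ j, m.surrogateCoeff j (θ k) * m.surrogateTerm j ϑ + reg R₁ R₂ ϑ)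
      m.domθ (θ (k + 1)) := by
  -- The constant terms of the linearizations of `f`; they depend on the current iterate only.
  set c : ℝ := ∑ ξ, m.posterior (θ k) ξ * ∑ t : Fin T,
    (m.f (m.ellAt t ((θ k).snd (ξ t.succ))) -
      deriv m.f (m.ellAt t ((θ k).snd (ξ t.succ))) * m.ellAt t ((θ k).snd (ξ t.succ)))
  have key : ∀ ϑ : Param d nz B,
      ∑ j, m.surrogateCoeff j (θ k) * m.surrogateTerm j ϑ + reg R₁ R₂ ϑ =
      (m.Q₁ (θ k) ϑ.fst + R₁ ϑ.fst) + (m.Q₂ (θ k) ϑ.snd + R₂ ϑ.snd) - c := by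
    intro ϑ
    have h1 : ∑ j, m.surrogateCoeff j (θ k) * m.surrogateTerm j ϑ =
        m.Q₁ (θ k) ϑ.fst + m.Q₂ (θ k) ϑ.snd - c := by
      rw [Fintype.sum_sum_type, Fintype.sum_prod_type, Q₁, Q₂, ← Finset.sum_add_distrib,
        ← Finset.sum_add_distrib, ← Finset.sum_sub_distrib]
      refine Finset.sum_congr rfl fun ξ _ => ?_
      simp only [surrogateCoeff, surrogateTerm, mul_assoc]
      rw [← Finset.mul_sum, ← mul_add, ← mul_add, ← mul_sub]
      congr 1
      rw [add_assoc, add_sub_assoc, PhiHat, ← Finset.sum_add_distrib, ← Finset.sum_sub_distrib]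
      congr 1
      refine Finset.sum_congr rfl fun t _ => ?_
      rw [linf]; ring
    rw [h1, reg]; ring
  intro ϑ hϑ
  have h1 := hθ.switch_min k (Set.mem_univ ϑ.fst)
  have h2 := hθ.subsys_min k hϑ
  simp only [Set.mem_ofPred_eq] at h1 h2 ⊢
  rw [key, key]
  linarith

variable [NormedAddCommGroup B] [InnerProductSpace ℝ B]

/-! ### The domain -/

lemma SubsystemAssumption.isOpen_domθ (hsub : m.SubsystemAssumption) :
    IsOpen (m.domθ : Set (Param d nz B)) := by
  have : (m.domθ : Set (Param d nz B)) = ⋂ j, {θ | θ.snd j ∈ m.Xβ} := by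
    ext θ; simp [domθ, domβ]
  rw [this]
  exact isOpen_iInter_of_finite fun j =>
    hsub.Xβ_open.preimage (by fun_prop : Continuous fun θ : Param d nz B => θ.snd j)

lemma SubsystemAssumption.convex_domθ (hsub : m.SubsystemAssumption) :
    Convex ℝ (m.domθ : Set (Param d nz B)) :=
  fun _ hx _ hy _ _ ha hb hab j => hsub.Xβ_convex (hx j) (hy j) ha hb hab

lemma contDiff_fst {n : WithTop ℕ∞} : ContDiff ℝ n (fun θ : Param d nz B => θ.fst) :=
  (WithLp.fstL 2 ℝ (SwitchParam d nz) (SubsysParam d B)).contDiff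

lemma contDiff_snd_apply {n : WithTop ℕ∞} (j : Fin d) :
    ContDiff ℝ n (fun θ : Param d nz B => θ.snd j) :=
  ((PiLp.proj 2 (𝕜 := ℝ) (fun _ : Fin d => B) j).comp
    (WithLp.sndL 2 ℝ (SwitchParam d nz) (SubsysParam d B))).contDiff

lemma contDiffOn_comp_snd {h : B → ℝ} (hh : ContDiffOn ℝ 1 h m.Xβ) (j : Fin d) :
    ContDiffOn ℝ 1 (fun θ : Param d nz B => h (θ.snd j)) m.domθ :=
  hh.comp (contDiff_snd_apply j).contDiffOn fun _ hθ => hθ j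

lemma convexOn_comp_snd (hsub : m.SubsystemAssumption) {h : B → ℝ} (hh : ConvexOn ℝ m.Xβ h)
    (j : Fin d) : ConvexOn ℝ m.domθ (fun θ : Param d nz B => h (θ.snd j)) :=
  ⟨hsub.convex_domθ, fun _ hx _ hy _ _ ha hb hab => hh.2 (hx j) (hy j) ha hb hab⟩

/-! ### Convexity and smoothness of the loss -/

lemma contDiffOn_Phi (hsub : m.SubsystemAssumption) (hsmooth : m.SmoothnessAssumption R₁ R₂)
    (ξ : Fin (T + 1) → Fin d) :
    ContDiffOn ℝ 1 (fun θ : Param d nz B => m.Phi ξ θ.snd) m.domθ := by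
  unfold Phi
  refine ContDiffOn.sum fun t _ => ContDiffOn.add ?_ ?_
  · exact hsub.f_contDiff.comp (contDiffOn_comp_snd (hsmooth.ell_smooth t).1 _)
      fun θ hθ => hsub.ell_mapsTo _ _ (hθ _)
  · exact contDiffOn_comp_snd (hsmooth.g_smooth t).1 _

lemma contDiffOn_joint (hm : m.WellPosed) (hsub : m.SubsystemAssumption)
    (hsmooth : m.SmoothnessAssumption R₁ R₂) (ξ : Fin (T + 1) → Fin d) :
    ContDiffOn ℝ 1 (fun θ : Param d nz B => m.joint θ ξ) m.domθ := by
  have := hm.nonempty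
  simp only [hm.joint_eq]
  exact contDiffOn_const.mul ((((contDiff_Psi m ξ).comp contDiff_fst).contDiffOn.add
    (contDiffOn_Phi hsub hsmooth ξ)).neg.exp)

lemma contDiffOn_posterior (hm : m.WellPosed) (hsub : m.SubsystemAssumption)
    (hsmooth : m.SmoothnessAssumption R₁ R₂) (ξ : Fin (T + 1) → Fin d) :
    ContDiffOn ℝ 1 (fun θ : Param d nz B => m.posterior θ ξ) m.domθ :=
  (contDiffOn_joint hm hsub hsmooth ξ).div
    (ContDiffOn.sum fun ξ' _ => contDiffOn_joint hm hsub hsmooth ξ')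
    fun θ _ => (hm.sum_joint_pos θ).ne'

lemma contDiffOn_regLoss (hm : m.WellPosed) (hsub : m.SubsystemAssumption)
    (hsmooth : m.SmoothnessAssumption R₁ R₂) : ContDiffOn ℝ 1 (m.regLoss R₁ R₂) m.domθ := by
  refine ContDiffOn.add (ContDiffOn.neg (ContDiffOn.log
    (ContDiffOn.sum fun ξ' _ => contDiffOn_joint hm hsub hsmooth ξ')
    fun θ _ => (hm.sum_joint_pos θ).ne')) (hsmooth.reg_contDiff.of_le (by norm_num))

lemma SubsystemAssumption.deriv_f_nonneg (hsub : m.SubsystemAssumption) {x : ℝ}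
    (hx : x ∈ m.Xf) : 0 ≤ deriv m.f x := by
  rw [← derivWithin_of_isOpen hsub.Xf_open hx]
  exact hsub.f_strictMono.monotoneOn.derivWithin_nonneg

lemma surrogateCoeff_nonneg (hm : m.WellPosed) (hsub : m.SubsystemAssumption) (j)
    (θ : Param d nz B) (hθ : θ ∈ m.domθ) : 0 ≤ m.surrogateCoeff j θ := by
  rcases j with ξ | ⟨ξ, t⟩
  · exact hm.posterior_nonneg θ ξ
  · exact mul_nonneg (hm.posterior_nonneg θ ξ)
      (hsub.deriv_f_nonneg (hsub.ell_mapsTo _ _ (hθ _)))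

lemma convexOn_surrogateTerm (hm : m.WellPosed) (hsub : m.SubsystemAssumption) (j) :
    ConvexOn ℝ m.domθ (m.surrogateTerm j : Param d nz B → ℝ) := by
  have := hm.nonempty
  rcases j with ξ | ⟨ξ, t⟩
  · have hPsi : ConvexOn ℝ m.domθ (fun θ : Param d nz B => m.Psi ξ θ.fst) :=
      ⟨hsub.convex_domθ, fun x _ y _ a b ha hb hab =>
        (convexOn_Psi m ξ).2 (Set.mem_univ x.fst) (Set.mem_univ y.fst) ha hb hab⟩
    have hg : ConvexOn ℝ m.domθ
        (fun θ : Param d nz B => ∑ t : Fin T, m.gAt t (θ.snd (ξ t.succ))) := by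
      have := Finset.univ.sum_induction
        (fun t : Fin T => fun θ : Param d nz B => m.gAt t (θ.snd (ξ t.succ))) (ConvexOn ℝ m.domθ)
        (fun _ _ => ConvexOn.add) (convexOn_const 0 hsub.convex_domθ)
        (fun t _ => convexOn_comp_snd hsub (hsub.g_convex _ _) _)
      convert this using 1
      ext x; simp
    exact hPsi.add hg
  · exact convexOn_comp_snd hsub (hsub.ell_convex _ _) _

lemma contDiffOn_surrogateTerm (hm : m.WellPosed) (hsmooth : m.SmoothnessAssumption R₁ R₂) (j) :
    ContDiffOn ℝ 1 (m.surrogateTerm j : Param d nz B → ℝ) m.domθ := by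
  have := hm.nonempty
  rcases j with ξ | ⟨ξ, t⟩
  · exact ((contDiff_Psi m ξ).comp contDiff_fst).contDiffOn.add
      (ContDiffOn.sum fun t _ => contDiffOn_comp_snd (hsmooth.g_smooth t).1 _)
  · exact contDiffOn_comp_snd (hsmooth.ell_smooth t).1 _

/-- The posterior is continuously differentiable. The factor from `f` is a composition whose outer
function is Lipschitz on the compact image of `S` under the inner one. -/
lemma exists_lipschitzOnWith_surrogateCoeff (hm : m.WellPosed) (hsub : m.SubsystemAssumption)
    (hsmooth : m.SmoothnessAssumption R₁ R₂) {S : Set (Param d nz B)} (hS : IsCompact S)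
    (hSD : S ⊆ m.domθ) (j) : ∃ C : NNReal, LipschitzOnWith C (m.surrogateCoeff j) S := by
  have hpost : ∀ ξ, ∃ C : NNReal, LipschitzOnWith C (fun θ : Param d nz B => m.posterior θ ξ) S :=
    fun ξ => exists_lipschitzOnWith_of_contDiffOn hsub.convex_domθ hS hSD
      (contDiffOn_posterior hm hsub hsmooth ξ)
  rcases j with ξ | ⟨ξ, t⟩
  · exact hpost ξ
  refine exists_lipschitzOnWith_mul hS (hpost ξ) ?_
  have hell := contDiffOn_comp_snd (nz := nz) (hsmooth.ell_smooth t).1 (ξ t.succ)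
  obtain ⟨C, hC⟩ := exists_lipschitzOnWith_of_contDiffOn hsub.convex_domθ hS hSD hell
  obtain ⟨L, hL⟩ := hsmooth.f_smooth.2 ((fun θ : Param d nz B => m.ellAt t (θ.snd (ξ t.succ))) '' S)
    (by rintro _ ⟨θ, hθ, rfl⟩; exact hsub.ell_mapsTo _ _ (hSD hθ _))
    (hS.image_of_continuousOn hC.continuousOn)
  have hL' : LipschitzOnWith L (deriv m.f)
      ((fun θ : Param d nz B => m.ellAt t (θ.snd (ξ t.succ))) '' S) := by
    refine LipschitzOnWith.of_dist_le_mul fun x hx y hy => ?_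
    refine le_trans ?_ (hL.dist_le_mul x hx y hy)
    rw [dist_eq_norm, dist_eq_norm, ← fderiv_apply_one_eq_deriv, ← fderiv_apply_one_eq_deriv,
      ← sub_apply]
    simpa using (fderiv ℝ m.f x - fderiv ℝ m.f y).le_opNorm 1
  exact ⟨L * C, hL'.comp hC (Set.mapsTo_image _ _)⟩

/-- Jensen's inequality over mode sequences, followed by the tangent bound for the concave `f`
inside each `Phi`; nonnegativity of the posterior preserves the inequality. -/
lemma regLoss_le_surrogate (hm : m.WellPosed) (hsub : m.SubsystemAssumption)
    (θ₀ : Param d nz B) (h₀ : θ₀ ∈ m.domθ) (θ : Param d nz B) (hθ : θ ∈ m.domθ) :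
    m.regLoss R₁ R₂ θ ≤ m.regLoss R₁ R₂ θ₀ +
      ∑ j, m.surrogateCoeff j θ₀ * (m.surrogateTerm j θ - m.surrogateTerm j θ₀) +
      (reg R₁ R₂ θ - reg R₁ R₂ θ₀) := by
  have h1 := hm.nll_le θ θ₀
  have h2 : ∑ ξ, m.posterior θ₀ ξ *
      ((m.Psi ξ θ.fst + m.Phi ξ θ.snd) - (m.Psi ξ θ₀.fst + m.Phi ξ θ₀.snd)) ≤
      ∑ j, m.surrogateCoeff j θ₀ * (m.surrogateTerm j θ - m.surrogateTerm j θ₀) := by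
    rw [Fintype.sum_sum_type, Fintype.sum_prod_type, ← Finset.sum_add_distrib]
    refine Finset.sum_le_sum fun ξ _ => ?_
    simp only [surrogateCoeff, surrogateTerm, mul_assoc]
    rw [← Finset.mul_sum, ← mul_add]
    refine mul_le_mul_of_nonneg_left ?_ (hm.posterior_nonneg θ₀ ξ)
    have h3 : m.Phi ξ θ.snd - m.Phi ξ θ₀.snd ≤
        ∑ t : Fin T, m.gAt t (θ.snd (ξ t.succ)) - ∑ t : Fin T, m.gAt t (θ₀.snd (ξ t.succ)) +
        ∑ t : Fin T, deriv m.f (m.ellAt t (θ₀.snd (ξ t.succ))) *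
          (m.ellAt t (θ.snd (ξ t.succ)) - m.ellAt t (θ₀.snd (ξ t.succ))) := by
      rw [Phi, Phi, ← Finset.sum_sub_distrib, ← Finset.sum_sub_distrib, ← Finset.sum_add_distrib]
      refine Finset.sum_le_sum fun t _ => ?_
      have hx : m.ellAt t (θ₀.snd (ξ t.succ)) ∈ m.Xf := hsub.ell_mapsTo _ _ (h₀ _)
      have hy : m.ellAt t (θ.snd (ξ t.succ)) ∈ m.Xf := hsub.ell_mapsTo _ _ (hθ _)
      have := concaveOn_le_tangent hsub.f_concave hx hy
        ((hsub.f_contDiff.differentiableOn (by norm_num)).differentiableAt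
          (hsub.Xf_open.mem_nhds hx))
      linarith
    linarith
  simp only [regLoss]
  linarith

/-! ### Coercivity -/

/-- The growth bounds are uniform in the mode sequence, so one exponential bounds every term of the
likelihood and the logarithm turns it into linear growth. -/
lemma exists_growth_regLoss (hm : m.WellPosed) (hreg : m.RegularizerAssumption R₁ R₂) :
    ∃ κ c : ℝ, 0 < κ ∧ ∀ θ ∈ m.domθ, κ * ‖θ‖ + c ≤ m.regLoss R₁ R₂ θ := by
  obtain ⟨κ₁, κ₂, c₁, c₂, h₁, h₂, h⟩ := hreg.growth
  refine ⟨min κ₁ κ₂, c₁ + c₂ - Real.log (∑ ξ, m.weight ξ), lt_min h₁ h₂, fun θ hθ => ?_⟩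
  set b : ℝ := κ₁ * ‖θ.fst‖ + c₁ + (κ₂ * ‖θ.snd‖ + c₂) - reg R₁ R₂ θ with hb
  have hW : 0 < ∑ ξ, m.weight ξ := by simpa using hm.sum_weight_exp_pos fun _ => 0
  have hsum : ∑ ξ, m.joint θ ξ ≤ (∑ ξ, m.weight ξ) * Real.exp (-b) := by
    rw [Finset.sum_mul]
    refine Finset.sum_le_sum fun ξ _ => ?_
    rw [hm.joint_eq]
    refine mul_le_mul_of_nonneg_left (Real.exp_le_exp.2 ?_) (hm.weight_nonneg ξ)
    have e1 := (h ξ).1 θ.fst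
    have e2 := (h ξ).2 θ.snd hθ
    rw [hb, reg]
    linarith
  have hlog := Real.log_le_log (hm.sum_joint_pos θ) hsum
  rw [Real.log_mul hW.ne' (Real.exp_pos _).ne', Real.log_exp] at hlog
  have hnorm : ‖θ‖ ≤ ‖θ.fst‖ + ‖θ.snd‖ := by
    rw [WithLp.prod_norm_eq_of_L2]
    refine Real.sqrt_le_iff.2 ⟨by positivity, ?_⟩
    nlinarith [norm_nonneg θ.fst, norm_nonneg θ.snd]
  have hκ : min κ₁ κ₂ * ‖θ‖ ≤ κ₁ * ‖θ.fst‖ + κ₂ * ‖θ.snd‖ := by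
    calc min κ₁ κ₂ * ‖θ‖ ≤ min κ₁ κ₂ * (‖θ.fst‖ + ‖θ.snd‖) :=
          mul_le_mul_of_nonneg_left hnorm (lt_min h₁ h₂).le
      _ = min κ₁ κ₂ * ‖θ.fst‖ + min κ₁ κ₂ * ‖θ.snd‖ := by ring
      _ ≤ _ := by gcongr; exacts [min_le_left _ _, min_le_right _ _]
  rw [regLoss, nll]
  linarith

/-- Linear growth gives boundedness. The domain is not assumed closed; closedness comes from lower
semicontinuity of the extension by `⊤`, which keeps limits of sublevel points inside the domain. -/
lemma isCompact_sublevel [FiniteDimensional ℝ B] (hm : m.WellPosed)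
    (hreg : m.RegularizerAssumption R₁ R₂)
    (hlsc : LowerSemicontinuous (m.extRegLoss R₁ R₂)) (r : ℝ) :
    IsCompact {θ ∈ (m.domθ : Set (Param d nz B)) | m.regLoss R₁ R₂ θ ≤ r} := by
  have heq : {θ ∈ (m.domθ : Set (Param d nz B)) | m.regLoss R₁ R₂ θ ≤ r} =
      m.extRegLoss R₁ R₂ ⁻¹' Set.Iic (r : EReal) := by
    ext θ
    by_cases hθ : θ ∈ m.domθ
    · simp [extRegLoss, hθ]
    · simp [extRegLoss, hθ]
  obtain ⟨κ, c, hκ, h⟩ := exists_growth_regLoss hm hreg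
  refine Metric.isCompact_of_isClosed_isBounded (heq ▸ hlsc.isClosed_preimage _) ?_
  refine (Metric.isBounded_closedBall (x := 0) (r := (r - c) / κ)).subset fun θ hθ => ?_
  rw [mem_closedBall_zero_iff, le_div_iff₀ hκ]
  linarith [h θ hθ.1, hθ.2]

end SwitchingModel

/-! ### The KL inequality for differentiable functions -/

section KLGradient

variable {E : Type*} [NormedAddCommGroup E] [InnerProductSpace ℝ E] [CompleteSpace E]
  {D : Set E} {η : E → EReal} {L : E → ℝ}

/-- The gradient of a differentiable function is a limiting subgradient. -/
lemma toDual_symm_fderiv_mem_subdifferential (hD : IsOpen D)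
    (hη : ∀ x ∈ D, η x = (L x : EReal)) {x : E} (hx : x ∈ D) (hL : DifferentiableAt ℝ L x) :
    (InnerProductSpace.toDual ℝ E).symm (fderiv ℝ L x) ∈ subdifferential η x := by
  set v := (InnerProductSpace.toDual ℝ E).symm (fderiv ℝ L x) with hv
  have htop : η x ≠ ⊤ := by rw [hη x hx]; exact EReal.coe_ne_top _
  have hbot : η x ≠ ⊥ := by rw [hη x hx]; exact EReal.coe_ne_bot _
  refine ⟨htop, hbot, fun _ => x, fun _ => v, tendsto_const_nhds, tendsto_const_nhds,
    fun _ => ⟨htop, hbot, fun ε hε => ?_⟩, tendsto_const_nhds⟩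
  have h1 := (hasFDerivAt_iff_isLittleO.1 hL.hasFDerivAt).def hε
  filter_upwards [h1, hD.mem_nhds hx] with y hy hyD
  rw [hη x hx, hη y hyD]
  have h2 : inner ℝ v (y - x) = fderiv ℝ L x (y - x) := by
    rw [hv, InnerProductSpace.toDual_symm_apply]
  rw [h2]
  have h3 := (abs_le.1 (Real.norm_eq_abs _ ▸ hy)).1
  have h4 : L x + (fderiv ℝ L x (y - x) - ε * ‖y - x‖) ≤ L y := by linarith
  exact_mod_cast h4

/-- The Kurdyka–Łojasiewicz inequality in terms of the derivative. -/
lemma IsKLFunctionAt.eventually_le (hD : IsOpen D) (hη : ∀ x ∈ D, η x = (L x : EReal))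
    (hL : DifferentiableOn ℝ L D) {x₀ : E} (hx₀ : x₀ ∈ D) {b : ℝ} {ψ : ℝ → ℝ}
    (h : IsKLFunctionAt η x₀ b ψ) :
    ∀ᶠ x in 𝓝 x₀, 0 < L x - L x₀ → L x - L x₀ < b →
      1 ≤ deriv ψ (L x - L x₀) * ‖fderiv ℝ L x‖ := by
  filter_upwards [h.ineq, hD.mem_nhds hx₀] with x hx hxD h0 hb
  rw [hη x hxD, hη x₀ hx₀] at hx
  have h1 := hx (by exact_mod_cast sub_pos.1 h0) (by exact_mod_cast (by linarith : L x < L x₀ + b))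
  simp only [EReal.toReal_coe] at h1
  have hd := h.deriv_pos _ ⟨h0, hb⟩
  -- The gradient is one subgradient, so its norm dominates the distance from `0` to the
  -- subdifferential; this one inequality is all that is needed.
  have h2 := Metric.infEDist_le_edist_of_mem (x := (0 : E))
    (toDual_symm_fderiv_mem_subdifferential hD hη hxD (hL.differentiableAt (hD.mem_nhds hxD)))
  rw [edist_dist, dist_zero_left, LinearIsometryEquiv.norm_map] at h2
  have h3 : (1 : ENNReal) ≤ ENNReal.ofReal (deriv ψ (L x - L x₀) * ‖fderiv ℝ L x‖) := by
    rw [ENNReal.ofReal_mul hd.le]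
    exact h1.trans (by gcongr)
  rwa [ENNReal.one_le_ofReal] at h3

end KLGradient

lemma deriv_const_mul_rpow {c α t : ℝ} (ht : 0 < t) :
    deriv (fun s : ℝ => c * s ^ (1 - α)) t = c * (1 - α) * t ^ (-α) := by
  have h := (Real.hasDerivAt_rpow_const (p := 1 - α) (Or.inl ht.ne')).const_mul c
  rw [h.deriv, show 1 - α - 1 = -α by ring]
  ring

end EMpp

end
-- Global convergence and rates of EM++
theorem mainTheorem1 {d ny nz ty T : ℕ} {B : Type*} [NormedAddCommGroup B] [InnerProductSpace ℝ B]
    [FiniteDimensional ℝ B]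
    (m : EMpp.SwitchingModel d ny nz ty T B)
    (R₁ : EMpp.SwitchParam d nz → ℝ) (R₂ : EMpp.SubsysParam d B → ℝ)
    (hm : m.WellPosed)
    (hsub : m.SubsystemAssumption)
    (hreg : m.RegularizerAssumption R₁ R₂)
    (hsmooth : m.SmoothnessAssumption R₁ R₂)
    (hKL : EMpp.SatisfiesKL (m.extRegLoss R₁ R₂))
    (θ : ℕ → EMpp.Param d nz B) (hθ : m.IsEMSequence R₁ R₂ θ) :
    ∃ θstar ∈ m.domθ,
      Tendsto θ atTop (𝓝 θstar) ∧
      HasFDerivAt (m.regLoss R₁ R₂) (0 : EMpp.Param d nz B →L[ℝ] ℝ) θstar ∧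
      ∀ c α : ℝ, 0 < c → 0 ≤ α → α < 1 →
        (∃ b : ℝ, EMpp.IsKLFunctionAt (m.extRegLoss R₁ R₂) θstar b
          (fun s => c * s ^ (1 - α))) →
        (α = 0 → ∃ N : ℕ, ∀ k ≥ N, θ k = θstar) ∧
        (0 < α → α ≤ 1 / 2 → ∃ ω τ : ℝ, 0 < ω ∧ 0 ≤ τ ∧ τ < 1 ∧
          ∀ k : ℕ, ‖θ k - θstar‖ ≤ ω * τ ^ k) ∧
        (1 / 2 < α → ∃ ω : ℝ, 0 < ω ∧
          ∀ k : ℕ, 1 ≤ k → ‖θ k - θstar‖ ≤ ω * (k : ℝ) ^ (-((1 - α) / (2 * α - 1)))) := by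
  open EMpp EMpp.SwitchingModel in
  set L : Param d nz B → ℝ := m.regLoss R₁ R₂ with hLdef
  set D : Set (Param d nz B) := m.domθ with hDdef
  have hD : IsOpen D := hsub.isOpen_domθ
  have hDc : Convex ℝ D := hsub.convex_domθ
  have hL1 : ContDiffOn ℝ 1 L D := contDiffOn_regLoss hm hsub hsmooth
  have hLd : DifferentiableOn ℝ L D := hL1.differentiableOn (by norm_num)
  have hη : ∀ x ∈ D, m.extRegLoss R₁ R₂ x = (L x : EReal) := fun x hx => extRegLoss_of_mem hx
  have hmem := hθ.mem_domθ
  have hmin := hθ.isMinOn_surrogate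
  have hmaj := fun x₀ h₀ x hx => regLoss_le_surrogate (R₁ := R₁) (R₂ := R₂) hm hsub x₀ h₀ x hx
  -- Plain monotonicity comes first: the constants `a` and `b` below are chosen for a compact set
  -- already known to contain all iterates.
  have hanti : Antitone fun k => L (θ k) := antitone_nat_of_succ_le fun k => by
    have h1 := hmaj (θ k) (hmem k) (θ (k + 1)) (hmem (k + 1))
    have h2 := hmin k (hmem k)
    simp only [Set.mem_ofPred_eq] at h2
    simp only [mul_sub, Finset.sum_sub_distrib] at h1
    linarith
  set S : Set (Param d nz B) := {x ∈ D | L x ≤ L (θ 0)} with hSdef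
  have hS : IsCompact S := isCompact_sublevel hm hreg hKL.lsc _
  have hSD : S ⊆ D := fun x hx => hx.1
  have hθS : ∀ k, θ k ∈ S := fun k => ⟨hmem k, hanti (Nat.zero_le k)⟩
  obtain ⟨a, ha, hdec⟩ := majorization_sufficient_decrease (L := L) hD hDc hS hSD
    hsmooth.reg_contDiff hsmooth.reg_hess_pos (surrogateCoeff_nonneg hm hsub)
    (convexOn_surrogateTerm hm hsub) hmaj
  obtain ⟨b, hb, herr⟩ := majorization_relative_error (L := L) hD hS hSD
    (hsmooth.reg_contDiff.differentiableOn (by norm_num)) hLd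
    (exists_lipschitzOnWith_surrogateCoeff hm hsub hsmooth hS hSD)
    (contDiffOn_surrogateTerm hm hsmooth) hmaj
  obtain ⟨θs, hθs, φ, hφ, hφlim⟩ := hS.tendsto_subseq hθS
  have hθsD : θs ∈ D := hSD hθs
  have hcl : MapClusterPt θs atTop θ := hφlim.mapClusterPt.of_comp hφ.tendsto_atTop
  have hLlim : Tendsto (fun k => L (θ k)) atTop (𝓝 (L θs)) := by
    -- Continuity gives the limit along the subsequence; monotonicity extends it to all iterates.
    have hc : Tendsto (fun n => L (θ (φ n))) atTop (𝓝 (L θs)) :=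
      (hL1.continuousOn.continuousAt (hD.mem_nhds hθsD)).tendsto.comp hφlim
    exact (tendsto_iff_tendsto_subseq_of_antitone hanti hφ.tendsto_atTop).2 hc
  set s : ℕ → ℝ := fun k => L (θ k) - L θs with hsdef
  have hs : Tendsto s atTop (𝓝 0) := by simpa using hLlim.sub_const (L θs)
  have hs0 : ∀ k, 0 ≤ s k := fun k => sub_nonneg.2 (hanti.le_of_tendsto hLlim k)
  have hdesc : ∀ k, s (k + 1) + a * ‖θ (k + 1) - θ k‖ ^ 2 ≤ s k := fun k => by
    have := hdec (θ k) (hθS k) (θ (k + 1)) (hθS (k + 1)) (hmin k)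
    simp only [hsdef]
    linarith
  have hgrad : ∀ k, ‖fderiv ℝ L (θ (k + 1))‖ ≤ b * ‖θ (k + 1) - θ k‖ := fun k =>
    herr (θ k) (hθS k) (θ (k + 1)) (hθS (k + 1)) (hmin k)
  have hKLseq : ∀ (β : ℝ) (ψ : ℝ → ℝ), IsKLFunctionAt (m.extRegLoss R₁ R₂) θs β ψ →
      ∃ ρ > 0, ∀ k, θ (k + 1) ∈ Metric.ball θs ρ → 0 < s (k + 1) → s (k + 1) < β →
        1 ≤ deriv ψ (s (k + 1)) * (b * ‖θ (k + 1) - θ k‖) := by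
    intro β ψ hψ
    obtain ⟨ρ, hρ, h⟩ := Metric.eventually_nhds_iff_ball.1 (hψ.eventually_le hD hη hLd hθsD)
    refine ⟨ρ, hρ, fun k hk h0 h1 => (h _ hk h0 h1).trans ?_⟩
    exact mul_le_mul_of_nonneg_left (hgrad k) (hψ.deriv_pos _ ⟨h0, h1⟩).le
  have hconv : ∀ (β : ℝ) (ψ : ℝ → ℝ), IsKLFunctionAt (m.extRegLoss R₁ R₂) θs β ψ →
      Tendsto θ atTop (𝓝 θs) ∧ ∃ N, ∀ k ≥ N,
        ‖θ (k + 1) - θs‖ ≤ ‖θ (k + 1) - θ k‖ + b / a * ψ (s (k + 1)) := by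
    intro β ψ hψ
    obtain ⟨ρ, hρ, h⟩ := hKLseq β ψ hψ
    exact descent_kl_tendsto ha hb hρ hs0 hs hdesc hcl hψ.b_pos hψ.nonneg hψ.concave
      (hψ.contDiff.differentiableOn (by norm_num)) hψ.deriv_pos h
  -- Any KL function at the cluster point yields convergence; the power-type one is used only for
  -- the rates.
  have hlim : Tendsto θ atTop (𝓝 θs) := by
    obtain ⟨β, ψ, hψ⟩ := hKL.kl θs (by rw [hη θs hθsD]; exact EReal.coe_ne_top _)
    exact (hconv β ψ hψ).1
  refine ⟨θs, hθsD, hlim, ?_, ?_⟩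
  · have hzero : fderiv ℝ L θs = 0 := by
      have h1 : Tendsto (fun k => ‖fderiv ℝ L (θ (k + 1))‖) atTop (𝓝 ‖fderiv ℝ L θs‖) :=
        ((((hL1.continuousOn_fderiv_of_isOpen hD le_rfl).continuousAt
          (hD.mem_nhds hθsD)).tendsto.comp hlim).comp (tendsto_add_atTop_nat 1)).norm
      have h2 : Tendsto (fun k => ‖fderiv ℝ L (θ (k + 1))‖) atTop (𝓝 0) :=
        squeeze_zero (fun k => norm_nonneg (fderiv ℝ L (θ (k + 1)))) hgrad
          (by simpa using (descent_step_tendsto_zero ha hs hdesc).const_mul b)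
      have h3 := tendsto_nhds_unique h1 h2
      exact (norm_eq_zero (a := fderiv ℝ L θs)).1 h3
    rw [← hzero]
    exact (hLd.differentiableAt (hD.mem_nhds hθsD)).hasFDerivAt
  rintro c α hc hα0 hα1 ⟨β, hψ⟩
  have hev : ∀ᶠ k in atTop, 0 < s (k + 1) →
      1 ≤ c * (1 - α) * s (k + 1) ^ (-α) * (b * ‖θ (k + 1) - θ k‖) := by
    obtain ⟨ρ, hρ, h⟩ := hKLseq β _ hψ
    filter_upwards [(hlim.comp (tendsto_add_atTop_nat 1)).eventually (Metric.ball_mem_nhds θs hρ),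
      (hs.comp (tendsto_add_atTop_nat 1)).eventually (gt_mem_nhds hψ.b_pos)] with k h1 h2 h0
    have := h k h1 h0 h2
    rwa [deriv_const_mul_rpow h0] at this
  have hc1 : 0 < c * (1 - α) := mul_pos hc (by linarith)
  refine ⟨?_, ?_, ?_⟩
  · rintro rfl
    obtain ⟨N, hN⟩ := descent_kl_finite (c := c) (b := b) hs0 ha hs hdesc
      (hev.mono fun k hk h0 => by simpa using hk h0)
    exact ⟨N, fun k hk => (descent_eq_of_gap_eq_zero ha hs0 hdesc hcl hN k hk).1⟩
  · intro hα hα2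
    obtain ⟨C, hC, hrec⟩ := descent_kl_recursion hs0 ha hb hc1 hα hdesc hev
    exact descent_linear_rate hs0 ha hs hlim hdesc (by linarith) hC hrec
  · intro hα
    obtain ⟨C, hC, hrec⟩ := descent_kl_recursion hs0 ha hb hc1 (by linarith) hdesc hev
    obtain ⟨N, hN⟩ := (hconv β _ hψ).2
    exact descent_sublinear_rate hs0 ha hb hc hα hα1 hs hcl hdesc hC hrec
      (eventually_atTop.2 ⟨N, hN⟩)
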